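/- Let $\mathbf{k}$ be a field of characteristic zero. For a $\mathbb{Z}$-graded $\mathbf{k}$-vector space $V$ let $\mathrm{Sym}^n(V)$ be its $n$-th graded symmetric power, and let $\mathbb{S}_{(i_1,\dots,i_r)}$ be the set of $(i_1,\dots,i_r)$-shuffles. For homogeneous elements $x_1,\dots,x_n$ the Koszul sign $\varepsilon(\sigma)=\varepsilon(\sigma;x_1,\dots,x_n)$ is the sign with $x_1\cdots x_n=\varepsilon(\sigma)\,x_{\sigma(1)}\cdots x_{\sigma(n)}$. In exponents of $-1$, an element stands for its degree. Definitions. (1) An $L_\infty$-algebra $(\mathfrak{g},\{l_k\}_{k\ge1})$ is a graded vector space with multilinear maps $l_k:\mathfrak{g}^{\otimes k}\to\mathfrak{g}$ of degree $1$ that are graded symmetric, $l_n(x_{\sigma(1)},\dots,x_{\sigma(n)})=\varepsilon(\sigma)\,l_n(x_1,\dots,x_n)$, and satisfy for all $n$ and all homogeneous $x_1,\dots,x_n$ $$\sum_{i=1}^{n}\sum_{\sigma\in\mathbb{S}_{(i,n-i)}}\varepsilon(\sigma)\,l_{n-i+1}\big(l_i(x_{\sigma(1)},\dots,x_{\sigma(i)}),x_{\sigma(i+1)},\dots,x_{\sigma(n)}\big)=0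 .$$ (2) An open-closed homotopy Lie algebra $(\mathfrak{g},\mathfrak{h},\{l_k\}_{k\ge1},\{R_{p,q}\}_{p+q\ge1})$ consists of an $L_\infty$-algebra $(\mathfrak{g},\{l_k\})$, a graded vector space $\mathfrak{h}$ and linear maps $R_{p,q}:\mathrm{Sym}^p(\mathfrak{g})\otimes\mathrm{Sym}^q(\mathfrak{h})\to\mathfrak{h}$ of degree $1$ ($p,q\ge0$, $p+q\ge1$) such that for all $n,m\ge0$ with $n+m\ge1$ and all homogeneous $x_1,\dots,x_n\in\mathfrak{g}$, $u_1,\dots,u_m\in\mathfrak{h}$ $$\sum_{i=1}^{n}\sum_{\sigma\in\mathbb{S}_{(i,n-i)}}\varepsilon(\sigma)R_{n-i+1,m}\big(l_i(x_{\sigma(1)},\dots,x_{\sigma(i)})x_{\sigma(i+1)}\cdots x_{\sigma(n)}\otimes u_1\cdots u_m\big)$$ $$+\sum_{i=0}^{n}\sum_{k=0}^{m}\sum_{\sigma\in\mathbb{S}_{(i,n-i)}}\sum_{\tau\in\mathbb{S}_{(k,m-k)}}\varepsilon(\sigma)\varepsilon(\tau)(-1)^{x_{\sigma(1)}+\dots+x_{\sigma(i)}}R_{i,m-k+1}\big(x_{\sigma(1)}\cdots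 x_{\sigma(i)}\otimes R_{n-i,k}(x_{\sigma(i+1)}\cdots x_{\sigma(n)}\otimes u_{\tau(1)}\cdots u_{\tau(k)})\,u_{\tau(k+1)}\cdots u_{\tau(m)}\big)=0,$$ where the term with $n-i=k=0$ is omitted (there is no $R_{0,0}$). (3) A post-Lie$_\infty$ algebra $(\mathfrak{g},\{M_{p,q}\}_{p\ge0,q\ge1})$ is a graded vector space with linear maps $M_{p,q}:\mathrm{Sym}^p(\mathfrak{g})\otimes\mathrm{Sym}^q(\mathfrak{g})\to\mathfrak{g}$ of degree $1$ such that for all $n\ge0$, $m\ge1$ and all homogeneous $x_1,\dots,x_n,y_1,\dots,y_m\in\mathfrak{g}$ $$\sum_{\substack{0\le j\le n-1,\ 1\le i\le n-j\\ \sigma\in\mathbb{S}_{(j,i,n-j-i)}}}\varepsilon(\sigma)M_{n-j-i+1,m}\big(M_{j,i}(x_{\sigma(1)}\cdots x_{\sigma(j)}\otimes x_{\sigma(j+1)}\cdots x_{\sigma(j+i)})\,x_{\sigma(j+i+1)}\cdots x_{\sigma(n)}\otimes y_1\cdots y_m\big)$$ $$+\sum_{j=0}^{n}\sum_{i=1}^{m}\sum_{\sigma\in\mathbb{S}_{(n-j,j)}}\sum_{\tau\in\mathbb{S}_{(i,m-i)}}\varepsilon(\sigma)\varepsilon(\tau)(-1)^{x_{\sigma(1)}+\dots+x_{\sigma(n-j)}}M_{n-j,m-i+1}\big(x_{\sigma(1)}\cdots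 x_{\sigma(n-j)}\otimes M_{j,i}(x_{\sigma(n-j+1)}\cdots x_{\sigma(n)}\otimes y_{\tau(1)}\cdots y_{\tau(i)})\,y_{\tau(i+1)}\cdots y_{\tau(m)}\big)=0 .$$ Theorem. Let $\mathfrak{g}$ be a $\mathbb{Z}$-graded $\mathbf{k}$-vector space and let $M_{p,q}:\mathrm{Sym}^p(\mathfrak{g})\otimes\mathrm{Sym}^q(\mathfrak{g})\to\mathfrak{g}$, $p\ge0$, $q\ge1$, be linear maps of degree $1$. Put $M_{p,0}=0$ for $p\ge1$, and for $k\ge1$ let $l^C_k:\mathfrak{g}^{\otimes k}\to\mathfrak{g}$ be the multilinear map given on homogeneous elements by $$l^C_k(x_1,\dots,x_k)=\sum_{j=0}^{k-1}\sum_{\sigma\in\mathbb{S}_{(j,k-j)}}\varepsilon(\sigma)\,M_{j,k-j}\big(x_{\sigma(1)}\cdots x_{\sigma(j)}\otimes x_{\sigma(j+1)}\cdots x_{\sigma(k)}\big).$$ Then $(\mathfrak{g},\{M_{p,q}\}_{p\ge0,q\ge1})$ is a post-Lie$_\infty$ algebra if and only if $(\mathfrak{g},\mathfrak{g},\{l^C_k\}_{k\ge1},\{M_{p,q}\}_{p+q\ge1})$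 is an open-closed homotopy Lie algebra. -/

import Mathlib

open Finset
open scoped TensorProduct DirectSum

noncomputable section

namespace PostLieInfty

/-! Throughout, a `ℤ`-graded vector space over a field `k` is a `k`-module `V` together with a
family of subspaces `𝒜 : ℤ → Submodule k V` and `[DirectSum.Decomposition 𝒜]`, that is
`V = ⨁ i, 𝒜 i`. A tuple `x : Fin n → V` is homogeneous of degrees `d : Fin n → ℤ` if
`x i ∈ 𝒜 (d i)` for all `i`. -/

/-! ### Koszul signs, shuffles, blocks of tuples -/

/-- The Koszul sign `ε(σ; x₁, …, xₙ)` for elements of degrees `d₁, …, dₙ`, i.e. the sign with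
`x₁ ⋯ xₙ = ε(σ) x_{σ(1)} ⋯ x_{σ(n)}` in the graded symmetric algebra: the product of
`(-1)^{d_{σ(s)} d_{σ(t)}}` over all inversions `s < t`, `σ(t) < σ(s)`. -/
def koszulSign {n : ℕ} (σ : Equiv.Perm (Fin n)) (d : Fin n → ℤ) : ℤˣ :=
  ∏ p ∈ (univ : Finset (Fin n × Fin n)).filter (fun p => p.1 < p.2 ∧ σ p.2 < σ p.1),
    Int.negOnePow (d (σ p.1) * d (σ p.2))

/-- The `(a, n - a)`-shuffles: permutations that are increasing on the first `a` positions and on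
the remaining ones. -/
def shuffles₂ (n a : ℕ) : Finset (Equiv.Perm (Fin n)) :=
  univ.filter fun σ => ∀ s t : Fin n, s < t → ((t : ℕ) < a ∨ a ≤ (s : ℕ)) → σ s < σ t

/-- The `(a, b, n - a - b)`-shuffles: permutations that are increasing on the first `a` positions,
on the next `b` positions, and on the remaining ones. -/
def shuffles₃ (n a b : ℕ) : Finset (Equiv.Perm (Fin n)) :=
  univ.filter fun σ => ∀ s t : Fin n, s < t →
    ((t : ℕ) < a ∨ (a ≤ (s : ℕ) ∧ (t : ℕ) < a + b) ∨ a + b ≤ (s : ℕ)) → σ s < σ t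

/-- The block `(x_{s+1}, …, x_{s+a})` (in 1-based numbering) of a tuple `(x₁, …, xₙ)`. It is only
used for `s + a ≤ n`, so that the default value never occurs. -/
def block {α : Type*} [Zero α] {n : ℕ} (x : Fin n → α) (s a : ℕ) : Fin a → α :=
  fun t => if h : s + (t : ℕ) < n then x ⟨s + t, h⟩ else 0

/-- The tuple `(v, w₁, …, wₙ)`. -/
def prepend {α : Type*} {n : ℕ} (v : α) (w : Fin n → α) : Fin (n + 1) → α :=
  Fin.cons v w

/-- The sign `(-1)^{d₁ + … + dₐ}`. -/
def headSign {n : ℕ} (d : Fin n → ℤ) (a : ℕ) : ℤˣ :=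
  Int.negOnePow (∑ t : Fin a, block d 0 a t)

section Sym

variable {k V : Type*} [Field k] [AddCommGroup V] [Module k V] (𝒜 : ℤ → Submodule k V)

/-! ### Graded symmetric powers -/

/-- The subspace of `V^{⊗ n}` spanned by all `x₁ ⊗ ⋯ ⊗ xₙ - ε(σ) x_{σ(1)} ⊗ ⋯ ⊗ x_{σ(n)}`
with `xᵢ` homogeneous. It is the part in tensor degree `n` of the two-sided ideal of the tensor
algebra generated by all `x ⊗ y - (-1)^{|x||y|} y ⊗ x`. -/
def symRel (n : ℕ) : Submodule k (⨂[k]^n V) :=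
  Submodule.span k
    {z | ∃ (d : Fin n → ℤ) (x : Fin n → V) (σ : Equiv.Perm (Fin n)), (∀ i, x i ∈ 𝒜 (d i)) ∧
      z = PiTensorProduct.tprod k x
        - koszulSign σ d • PiTensorProduct.tprod k (fun i => x (σ i))}

/-- The graded symmetric power `Sym^n(V)`. -/
abbrev GSym (n : ℕ) : Type _ := (⨂[k]^n V) ⧸ symRel 𝒜 n

/-- The product `x₁ ⋯ xₙ ∈ Sym^n(V)`, as a multilinear map in `(x₁, …, xₙ)`. -/
def mon (n : ℕ) : MultilinearMap k (fun _ : Fin n => V) (GSym 𝒜 n) :=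
  (symRel 𝒜 n).mkQ.compMultilinearMap (PiTensorProduct.tprod k)

variable {W : Type*} [AddCommGroup W] [Module k W] (ℬ : ℤ → Submodule k W)

/-- The element `x₁ ⋯ x_p ⊗ y₁ ⋯ y_q` of `Sym^p(V) ⊗ Sym^q(W)`. -/
def mon₂ {p q : ℕ} (x : Fin p → V) (y : Fin q → W) : GSym 𝒜 p ⊗[k] GSym ℬ q :=
  mon 𝒜 p x ⊗ₜ[k] mon ℬ q y

/-- A linear map `Sym^p(V) ⊗ Sym^q(W) → W` has degree `1`. -/
def IsDegreeOne {p q : ℕ} (R : GSym 𝒜 p ⊗[k] GSym ℬ q →ₗ[k] W) : Prop :=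
  ∀ (d : Fin p → ℤ) (e : Fin q → ℤ) (x : Fin p → V) (y : Fin q → W),
    (∀ i, x i ∈ 𝒜 (d i)) → (∀ i, y i ∈ ℬ (e i)) →
      R (mon₂ 𝒜 ℬ x y) ∈ ℬ (∑ i, d i + ∑ i, e i + 1)

/-! ### `L_∞`-algebras, open-closed homotopy Lie algebras, post-Lie`_∞` algebras -/

/-- `(V, {l_k}_{k ≥ 1})` is an `L_∞`-algebra (in the convention where all operations are graded
symmetric of degree `1`). The component `l 0` plays no role. -/
structure IsLInfty (l : ∀ n : ℕ, MultilinearMap k (fun _ : Fin n => V) V) : Prop where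
  degree_one : ∀ n, 1 ≤ n → ∀ (d : Fin n → ℤ) (x : Fin n → V), (∀ i, x i ∈ 𝒜 (d i)) →
    l n x ∈ 𝒜 (∑ i, d i + 1)
  graded_symm : ∀ n, 1 ≤ n → ∀ (d : Fin n → ℤ) (x : Fin n → V), (∀ i, x i ∈ 𝒜 (d i)) →
    ∀ σ : Equiv.Perm (Fin n), l n (x ∘ σ) = koszulSign σ d • l n x
  jacobi : ∀ (n : ℕ) (d : Fin n → ℤ) (x : Fin n → V), (∀ i, x i ∈ 𝒜 (d i)) →
    ∑ i ∈ Icc 1 n, ∑ σ ∈ shuffles₂ n i,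
      koszulSign σ d •
        l (n - i + 1) (prepend (l i (block (x ∘ σ) 0 i)) (block (x ∘ σ) i (n - i))) = 0

/-- `(V, W, {l_k}_{k ≥ 1}, {R_{p,q}}_{p + q ≥ 1})` is an open-closed homotopy Lie algebra.
The components `l 0` and `R 0 0` play no role; the condition `1 ≤ n - i + j` below removes the
terms that would contain `R_{0,0}`. -/
structure IsOpenClosed (l : ∀ n : ℕ, MultilinearMap k (fun _ : Fin n => V) V)
    (R : ∀ p q : ℕ, GSym 𝒜 p ⊗[k] GSym ℬ q →ₗ[k] W) : Prop where
  lInfty : IsLInfty 𝒜 l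
  degree_one : ∀ p q, 1 ≤ p + q → IsDegreeOne 𝒜 ℬ (R p q)
  compat : ∀ n m : ℕ, 1 ≤ n + m →
    ∀ (d : Fin n → ℤ) (e : Fin m → ℤ) (x : Fin n → V) (u : Fin m → W),
    (∀ i, x i ∈ 𝒜 (d i)) → (∀ i, u i ∈ ℬ (e i)) →
    (∑ i ∈ Icc 1 n, ∑ σ ∈ shuffles₂ n i,
      koszulSign σ d •
        R (n - i + 1) m
          (mon₂ 𝒜 ℬ (prepend (l i (block (x ∘ σ) 0 i)) (block (x ∘ σ) i (n - i))) u))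
    + (∑ i ∈ range (n + 1), ∑ j ∈ (range (m + 1)).filter (fun j => 1 ≤ n - i + j),
        ∑ σ ∈ shuffles₂ n i, ∑ τ ∈ shuffles₂ m j,
        (koszulSign σ d * koszulSign τ e * headSign (d ∘ σ) i) •
          R i (m - j + 1)
            (mon₂ 𝒜 ℬ (block (x ∘ σ) 0 i)
              (prepend
                (R (n - i) j (mon₂ 𝒜 ℬ (block (x ∘ σ) i (n - i)) (block (u ∘ τ) 0 j)))
                (block (u ∘ τ) j (m - j))))) = 0

/-- `(V, {M_{p,q}}_{p ≥ 0, q ≥ 1})` is a post-Lie`_∞` algebra. The components `M p 0` play no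
role. -/
structure IsPostLieInfty (M : ∀ p q : ℕ, GSym 𝒜 p ⊗[k] GSym 𝒜 q →ₗ[k] V) : Prop where
  degree_one : ∀ p q, 1 ≤ q → IsDegreeOne 𝒜 𝒜 (M p q)
  maurer_cartan : ∀ n m : ℕ, 1 ≤ m →
    ∀ (d : Fin n → ℤ) (e : Fin m → ℤ) (x : Fin n → V) (y : Fin m → V),
    (∀ i, x i ∈ 𝒜 (d i)) → (∀ i, y i ∈ 𝒜 (e i)) →
    (∑ j ∈ range n, ∑ i ∈ Icc 1 (n - j), ∑ σ ∈ shuffles₃ n j i,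
      koszulSign σ d •
        M (n - j - i + 1) m
          (mon₂ 𝒜 𝒜
            (prepend
              (M j i (mon₂ 𝒜 𝒜 (block (x ∘ σ) 0 j) (block (x ∘ σ) j i)))
              (block (x ∘ σ) (j + i) (n - j - i)))
            y))
    + (∑ j ∈ range (n + 1), ∑ i ∈ Icc 1 m,
        ∑ σ ∈ shuffles₂ n (n - j), ∑ τ ∈ shuffles₂ m i,
        (koszulSign σ d * koszulSign τ e * headSign (d ∘ σ) (n - j)) •
          M (n - j) (m - i + 1)
            (mon₂ 𝒜 𝒜 (block (x ∘ σ) 0 (n - j))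
              (prepend
                (M j i (mon₂ 𝒜 𝒜 (block (x ∘ σ) (n - j) j) (block (y ∘ τ) 0 i)))
                (block (y ∘ τ) i (m - i))))) = 0

/-- The family `{M_{p,q}}_{p ≥ 0, q ≥ 1}`, extended by `M_{p,0} = 0`. -/
def extendByZero (M : ∀ p q : ℕ, GSym 𝒜 p ⊗[k] GSym 𝒜 q →ₗ[k] V) (p q : ℕ) :
    GSym 𝒜 p ⊗[k] GSym 𝒜 q →ₗ[k] V :=
  if q = 0 then 0 else M p q

/-! ### The operations `l^C_k` -/

/-- The identification of `{1, …, j} ⊔ {1, …, n - j}` with `{1, …, n}`, for `j < n`. -/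
def splitEquiv {n : ℕ} (j : Fin n) : Fin (j : ℕ) ⊕ Fin (n - j) ≃ Fin n :=
  finSumFinEquiv.trans (finCongr (Nat.add_sub_of_le j.2.le))

/-- The multilinear map
`(x₁, …, xₙ) ↦ M_{j,n-j}(x_{σ(1)} ⋯ x_{σ(j)} ⊗ x_{σ(j+1)} ⋯ x_{σ(n)})`. -/
def subadjacentTerm (M : ∀ p q : ℕ, GSym 𝒜 p ⊗[k] GSym 𝒜 q →ₗ[k] V) {n : ℕ} (j : Fin n)
    (σ : Equiv.Perm (Fin n)) : MultilinearMap k (fun _ : Fin n => V) V :=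
  (M j (n - j)).compMultilinearMap
    (((mon 𝒜 (j : ℕ)).domCoprod (mon 𝒜 (n - j))).domDomCongr ((splitEquiv j).trans σ))

theorem subadjacentTerm_apply (M : ∀ p q : ℕ, GSym 𝒜 p ⊗[k] GSym 𝒜 q →ₗ[k] V) {n : ℕ}
    (j : Fin n) (σ : Equiv.Perm (Fin n)) (x : Fin n → V) :
    subadjacentTerm 𝒜 M j σ x =
      M j (n - j) (mon₂ 𝒜 𝒜 (block (x ∘ σ) 0 j) (block (x ∘ σ) j (n - j))) := by
  have hj := j.2
  have h1 : (fun i : Fin (j : ℕ) => x (σ (splitEquiv j (Sum.inl i)))) = block (x ∘ σ) 0 j := by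
    funext i
    have : 0 + (i : ℕ) < n := by omega
    rw [block, dif_pos this]
    simp only [Function.comp]
    congr 2
    ext
    simp [splitEquiv]
  have h2 : (fun i : Fin (n - j) => x (σ (splitEquiv j (Sum.inr i)))) =
      block (x ∘ σ) j (n - j) := by
    funext i
    have : (j : ℕ) + (i : ℕ) < n := by omega
    rw [block, dif_pos this]
    simp only [Function.comp]
    congr 2
  rw [mon₂, ← h1, ← h2]
  rfl

variable [DirectSum.Decomposition 𝒜]

/-- The operations `l^C_n`: the multilinear maps given on homogeneous elements by
`l^C_n(x₁, …, xₙ) = ∑_{j=0}^{n-1} ∑_{σ ∈ S_{(j,n-j)}} ε(σ)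
  M_{j,n-j}(x_{σ(1)} ⋯ x_{σ(j)} ⊗ x_{σ(j+1)} ⋯ x_{σ(n)})`,
see `subadjacent_apply`. As the Koszul sign is defined for homogeneous elements, the formula is
extended multilinearly along `V = ⨁ i, 𝒜 i`. -/
def subadjacent (M : ∀ p q : ℕ, GSym 𝒜 p ⊗[k] GSym 𝒜 q →ₗ[k] V) (n : ℕ) :
    MultilinearMap k (fun _ : Fin n => V) V :=
  (MultilinearMap.fromDirectSumEquiv (ι := Fin n) (κ := fun _ => ℤ)
      (M := fun _ (i : ℤ) => 𝒜 i)
    (fun d => ∑ j : Fin n, ∑ σ ∈ shuffles₂ n j,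
      koszulSign σ d •
        (subadjacentTerm 𝒜 M j σ).compLinearMap (fun i => (𝒜 (d i)).subtype))).compLinearMap
    (fun _ => (DirectSum.decomposeLinearEquiv 𝒜).toLinearMap)

theorem subadjacent_apply (M : ∀ p q : ℕ, GSym 𝒜 p ⊗[k] GSym 𝒜 q →ₗ[k] V) (n : ℕ)
    (d : Fin n → ℤ) (x : Fin n → V) (hx : ∀ i, x i ∈ 𝒜 (d i)) :
    subadjacent 𝒜 M n x =
      ∑ j ∈ range n, ∑ σ ∈ shuffles₂ n j,
        koszulSign σ d •
          M j (n - j) (mon₂ 𝒜 𝒜 (block (x ∘ σ) 0 j) (block (x ∘ σ) j (n - j))) := by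
  have key : (fun i => (DirectSum.decomposeLinearEquiv 𝒜) (x i)) =
      fun i => DirectSum.lof k ℤ (fun i => 𝒜 i) (d i) ⟨x i, hx i⟩ := by
    funext i
    exact DirectSum.decomposeLinearEquiv_apply_coe 𝒜 (d i) ⟨x i, hx i⟩
  rw [subadjacent, MultilinearMap.compLinearMap_apply]
  simp only [LinearEquiv.coe_coe]
  rw [key, MultilinearMap.fromDirectSumEquiv_lof, Finset.sum_range]
  simp only [_root_.sum_apply, _root_.smul_apply,
    MultilinearMap.compLinearMap_apply, Submodule.subtype_apply, subadjacentTerm_apply]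

end Sym

end PostLieInfty

end

/-!
The compatibility condition of an open-closed homotopy Lie algebra for the operations `l^C` and the
`M_{p,q}` is the identity of a post-Lie`_∞` algebra: in the first sum, the shuffles in the
definition of the inner `l^C` and the outer shuffles combine to shuffles of three blocks, and in the
second one the terms with `M_{p,0} = 0` drop out. For `m = 0` all terms vanish. Hence one direction
is clear, and for the other one it remains to prove that the `l^C_k` form an `L_∞`-algebra.

For this, write `MC(x; y)` for the left hand side of the identity of a post-Lie`_∞` algebra. In the
Jacobi expression of the `l^C`, the outer `l^C` puts the value of the inner one into the first or
into the second factor of `Sym ⊗ Sym`, and it distributes the other arguments to the two factors.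
Collecting the arguments `x'` that end up in the first factor and `x''` that end up in the second
one, where the arguments of an inner operation `M_{a,b}` in the second factor are divided in the same
way, the Jacobi expression becomes the sum of `± MC(x'; x'')` over all ways to divide the arguments
into `x'` and `x''` (`jacobi_eq_sum_mcSum`). The sign `(-1)^{x_1 + … + x_c}` in `MC` arises as
follows: moving the arguments of the inner operation past `x_1, …, x_c` and moving its value back
gives two Koszul signs that differ by this one, because the operation has degree one
(`sum_blockRot_eq_jacobiRight`).

To handle the shuffles, every sum over shuffles is replaced by a sum over the whole symmetric group,
divided by the orders of the symmetric groups of the blocks (`sum_shuffles₂_eq`,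
`sum_shuffles₃_eq`). This is possible in characteristic zero as the terms are graded symmetric
within the blocks. Nested sums then collapse: by the cocycle property of the Koszul sign
(`koszulSign_mul`), a sum over the permutations of a block inside of a sum over all permutations
contributes only the factor given by the number of these permutations
(`sum_koszulSign_smul_sum_blockPerm`). An operation `l^C (v, w₁, …, w_m)` is expanded by
sorting the permutations by the position of `v` (`sum_perm_succ`, `subadjacent_prepend`).
-/

noncomputable section

namespace PostLieInfty

/-! ### Koszul signs -/

/-- A product over unordered pairs of positions does not change when the positions are permuted. -/
theorem prod_lt_comp_perm {n : ℕ} (f : Fin n → Fin n → ℤˣ) (hf : ∀ s t, f s t = f t s)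
    (τ : Equiv.Perm (Fin n)) :
    ∏ p ∈ (univ : Finset (Fin n × Fin n)).filter (fun p => p.1 < p.2), f (τ p.1) (τ p.2) =
      ∏ p ∈ (univ : Finset (Fin n × Fin n)).filter (fun p => p.1 < p.2), f p.1 p.2 := by
  have key : ∀ (ρ π : Equiv.Perm (Fin n)), (∀ a, π (ρ a) = a) → ∀ a b : Fin n, a < b →
      (fun q : Fin n × Fin n => if π q.1 < π q.2 then (π q.1, π q.2) else (π q.2, π q.1))
        ((fun q : Fin n × Fin n => if ρ q.1 < ρ q.2 then (ρ q.1, ρ q.2) else (ρ q.2, ρ q.1))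
          (a, b)) = (a, b) := by
    intro ρ π h a b hab
    by_cases h1 : ρ a < ρ b
    · simp [h1, h, hab]
    · simp [h1, h, hab.not_gt]
  have mem : ∀ (ρ : Equiv.Perm (Fin n)) (a b : Fin n), a < b →
      (if ρ a < ρ b then (ρ a, ρ b) else (ρ b, ρ a)).1 <
        (if ρ a < ρ b then (ρ a, ρ b) else (ρ b, ρ a)).2 := by
    intro ρ a b hab
    split_ifs with h1
    · exact h1
    · exact lt_of_le_of_ne (not_lt.1 h1) fun h => hab.ne' (ρ.injective h)
  refine Finset.prod_nbij'
    (fun q => if τ q.1 < τ q.2 then (τ q.1, τ q.2) else (τ q.2, τ q.1))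
    (fun q => if τ.symm q.1 < τ.symm q.2 then (τ.symm q.1, τ.symm q.2)
      else (τ.symm q.2, τ.symm q.1)) ?_ ?_ ?_ ?_ ?_
  · rintro ⟨a, b⟩ h
    simp only [mem_filter, mem_univ, true_and] at h ⊢
    exact mem τ a b h
  · rintro ⟨a, b⟩ h
    simp only [mem_filter, mem_univ, true_and] at h ⊢
    exact mem τ.symm a b h
  · rintro ⟨a, b⟩ h
    exact key τ τ.symm (by simp) a b (by simpa using h)
  · rintro ⟨a, b⟩ h
    exact key τ.symm τ (by simp) a b (by simpa using h)
  · rintro ⟨a, b⟩ h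
    dsimp only
    split_ifs
    · rfl
    · exact hf _ _

theorem koszulSign_eq_prod_ite {n : ℕ} (σ : Equiv.Perm (Fin n)) (d : Fin n → ℤ) :
    koszulSign σ d =
      ∏ p ∈ (univ : Finset (Fin n × Fin n)).filter (fun p => p.1 < p.2),
        if σ p.2 < σ p.1 then Int.negOnePow (d (σ p.1) * d (σ p.2)) else 1 := by
  rw [koszulSign, ← filter_filter, prod_filter (fun p : Fin n × Fin n => σ p.2 < σ p.1)]

/-- The Koszul sign is a cocycle: reordering by `σ` and then by `τ` multiplies the signs. -/
theorem koszulSign_mul {n : ℕ} (σ τ : Equiv.Perm (Fin n)) (d : Fin n → ℤ) :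
    koszulSign (σ * τ) d = koszulSign σ d * koszulSign τ (d ∘ σ) := by
  -- `s < t ↔ σ t < σ s` is symmetric in `s ≠ t`, so it describes inverted unordered pairs
  set g : Fin n → Fin n → ℤˣ := fun s t =>
    if (s < t ↔ σ t < σ s) then Int.negOnePow (d (σ s) * d (σ t)) else 1 with hg
  have hsymm : ∀ s t, g s t = g t s := by
    intro s t
    rcases eq_or_ne s t with rfl | hst
    · rfl
    · have h1 : (s < t ↔ σ t < σ s) ↔ (t < s ↔ σ s < σ t) := by
        have h2 := σ.injective.ne hst
        rcases lt_or_gt_of_ne hst with h | h <;> rcases lt_or_gt_of_ne h2 with h' | h' <;>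
          simp [h, h', h.not_gt, h'.not_gt]
      simp only [hg, h1, mul_comm]
  have h0 : koszulSign σ d =
      ∏ p ∈ (univ : Finset (Fin n × Fin n)).filter (fun p => p.1 < p.2), g (τ p.1) (τ p.2) := by
    rw [prod_lt_comp_perm g hsymm, koszulSign_eq_prod_ite]
    refine prod_congr rfl ?_
    rintro ⟨s, t⟩ h
    have h' : s < t := by simpa using h
    simp [hg, h']
  rw [h0, koszulSign_eq_prod_ite, koszulSign_eq_prod_ite, ← prod_mul_distrib]
  refine prod_congr rfl ?_
  rintro ⟨s, t⟩ h
  have h' : s < t := by simpa using h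
  have h2 := τ.injective.ne h'.ne
  have h3 := σ.injective.ne h2
  simp only [hg, Equiv.Perm.mul_apply, Function.comp]
  rcases lt_or_gt_of_ne h2 with h4 | h4 <;> rcases lt_or_gt_of_ne h3 with h5 | h5 <;>
    simp [h4, h5, h4.not_gt, h5.not_gt, mul_comm]

theorem koszulSign_mul_self {n : ℕ} (σ : Equiv.Perm (Fin n)) (d : Fin n → ℤ) :
    koszulSign σ d * koszulSign σ d = 1 :=
  Int.units_mul_self _

/-! ### Blocks and permutations of blocks -/

theorem block_apply {α : Type*} [Zero α] {n : ℕ} (x : Fin n → α) {s a : ℕ} (t : Fin a)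
    (h : s + (t : ℕ) < n) : block x s a t = x ⟨s + t, h⟩ := by
  rw [block, dif_pos h]

theorem block_block {α : Type*} [Zero α] {n : ℕ} (x : Fin n → α) {s a s' a' : ℕ}
    (h : s' + a' ≤ a) : block (block x s a) s' a' = block x (s + s') a' := by
  funext t
  have ht := t.2
  have h1 : s' + (t : ℕ) < a := by omega
  rw [block_apply _ _ h1]
  simp only [block, add_assoc]

theorem block_zero_self {α : Type*} [Zero α] {n : ℕ} (x : Fin n → α) : block x 0 n = x := by
  funext t
  have h : 0 + (t : ℕ) < n := by omega
  rw [block_apply _ _ h]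
  simp

theorem block_mem {k V : Type*} [Field k] [AddCommGroup V] [Module k V] {𝒜 : ℤ → Submodule k V}
    {n : ℕ} {d : Fin n → ℤ} {x : Fin n → V} (hx : ∀ i, x i ∈ 𝒜 (d i)) (s a : ℕ) (i : Fin a) :
    block x s a i ∈ 𝒜 (block d s a i) := by
  simp only [block]
  split_ifs
  · exact hx _
  · exact zero_mem _

/-- The embedding of a block of length `a`, starting after `s` positions. -/
def blockEmb {n s a : ℕ} (h : s + a ≤ n) : Fin a ↪ Fin n :=
  ⟨fun t => ⟨s + t, by omega⟩, fun t t' htt' => by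
    ext; simpa using htt'⟩

theorem blockEmb_val {n s a : ℕ} (h : s + a ≤ n) (t : Fin a) : (blockEmb h t : ℕ) = s + t := rfl

theorem blockEmb_lt_iff {n s a : ℕ} (h : s + a ≤ n) {t t' : Fin a} :
    blockEmb h t < blockEmb h t' ↔ t < t' := by
  rw [Fin.lt_def, Fin.lt_def, blockEmb_val, blockEmb_val, Nat.add_lt_add_iff_left]

/-- The permutation of `{1, …, n}` that permutes a block of `a` consecutive positions by `τ` and
fixes all others. -/
def blockPerm {n s a : ℕ} (h : s + a ≤ n) (τ : Equiv.Perm (Fin a)) : Equiv.Perm (Fin n) :=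
  τ.viaEmbedding (blockEmb h)

theorem blockPerm_apply {n s a : ℕ} (h : s + a ≤ n) (τ : Equiv.Perm (Fin a)) (t : Fin a) :
    blockPerm h τ (blockEmb h t) = blockEmb h (τ t) :=
  Equiv.Perm.viaEmbedding_apply _ _ _

theorem exists_blockEmb {n s a : ℕ} (h : s + a ≤ n) (i : Fin n) (h1 : s ≤ i)
    (h2 : (i : ℕ) < s + a) :
    ∃ t : Fin a, blockEmb h t = i :=
  ⟨⟨i - s, by omega⟩, by ext; rw [blockEmb_val]; simp only; omega⟩

theorem blockPerm_apply_of_not_mem {n s a : ℕ} (h : s + a ≤ n) (τ : Equiv.Perm (Fin a)) (i : Fin n)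
    (hi : (i : ℕ) < s ∨ s + a ≤ i) : blockPerm h τ i = i := by
  refine Equiv.Perm.viaEmbedding_apply_of_notMem _ _ _ ?_
  rintro ⟨t, rfl⟩
  have := t.2
  rw [blockEmb_val] at hi
  omega

theorem blockPerm_mul {n s a : ℕ} (h : s + a ≤ n) (τ τ' : Equiv.Perm (Fin a)) :
    blockPerm h (τ * τ') = blockPerm h τ * blockPerm h τ' :=
  map_mul (Equiv.Perm.viaEmbeddingHom (blockEmb h)) τ τ'

theorem blockPerm_one {n s a : ℕ} (h : s + a ≤ n) :
    blockPerm h (1 : Equiv.Perm (Fin a)) = 1 :=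
  map_one (Equiv.Perm.viaEmbeddingHom (blockEmb h))

theorem blockPerm_injective {n s a : ℕ} (h : s + a ≤ n) :
    Function.Injective (blockPerm h) :=
  Equiv.Perm.viaEmbeddingHom_injective (blockEmb h)

theorem block_comp_blockPerm {α : Type*} [Zero α] {n s a : ℕ} (h : s + a ≤ n) (x : Fin n → α)
    (τ : Equiv.Perm (Fin a)) : block (x ∘ blockPerm h τ) s a = block x s a ∘ τ := by
  funext t
  have ht := t.2
  have ht' := (τ t).2
  rw [Function.comp, block_apply _ _ (by omega), block_apply _ _ (by omega)]
  exact congrArg x (blockPerm_apply h τ t)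

/-- Permuting one block does not affect a block disjoint from it. -/
theorem block_comp_blockPerm_of_disjoint {α : Type*} [Zero α] {n s a : ℕ} (h : s + a ≤ n)
    (x : Fin n → α) (τ : Equiv.Perm (Fin a)) {s' a' : ℕ} (hd : s' + a' ≤ s ∨ s + a ≤ s') :
    block (x ∘ blockPerm h τ) s' a' = block x s' a' := by
  funext t
  have ht := t.2
  simp only [block, Function.comp]
  split_ifs with h'
  · rw [blockPerm_apply_of_not_mem]
    simp only
    omega
  · rfl

/-- Only pairs of positions inside of the block can be inverted. -/
theorem koszulSign_blockPerm {n s a : ℕ} (h : s + a ≤ n) (τ : Equiv.Perm (Fin a))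
    (d : Fin n → ℤ) : koszulSign (blockPerm h τ) d = koszulSign τ (block d s a) := by
  symm
  refine Finset.prod_nbij (fun p => (blockEmb h p.1, blockEmb h p.2)) ?_ ?_ ?_ ?_
  · rintro ⟨t, t'⟩ hp
    simpa [blockPerm_apply, blockEmb_lt_iff] using hp
  · rintro ⟨t, t'⟩ - ⟨u, u'⟩ - hp
    simpa using hp
  · rintro ⟨i, i'⟩ hp
    simp only [coe_filter, mem_univ, true_and, Set.mem_ofPred_eq] at hp
    obtain ⟨h1, h2⟩ := hp
    -- a pair with one entry outside of the block is not inverted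
    have hmem : ∀ j : Fin n, (s ≤ j ∧ (j : ℕ) < s + a) ∨ ((j : ℕ) < s ∨ s + a ≤ j) := by
      intro j; omega
    have hin : ∀ j : Fin n, (s ≤ j ∧ (j : ℕ) < s + a) →
        s ≤ blockPerm h τ j ∧ (blockPerm h τ j : ℕ) < s + a := by
      rintro j ⟨hj1, hj2⟩
      obtain ⟨t, rfl⟩ := exists_blockEmb h j hj1 hj2
      rw [blockPerm_apply]
      have := (τ t).2
      rw [blockEmb_val]
      omega
    rw [Fin.lt_def] at h1 h2
    rcases hmem i with hi | hi <;> rcases hmem i' with hi' | hi'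
    · obtain ⟨t, rfl⟩ := exists_blockEmb h i hi.1 hi.2
      obtain ⟨t', rfl⟩ := exists_blockEmb h i' hi'.1 hi'.2
      refine ⟨(t, t'), ?_, rfl⟩
      rw [← Fin.lt_def] at h1 h2
      rw [blockPerm_apply, blockPerm_apply] at h2
      simpa using And.intro ((blockEmb_lt_iff h).1 h1) ((blockEmb_lt_iff h).1 h2)
    · rw [blockPerm_apply_of_not_mem h τ i' hi'] at h2
      have := hin i hi
      omega
    · rw [blockPerm_apply_of_not_mem h τ i hi] at h2
      have := hin i' hi'
      omega
    · rw [blockPerm_apply_of_not_mem h τ i hi, blockPerm_apply_of_not_mem h τ i' hi'] at h2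
      omega
  · rintro ⟨t, t'⟩ hp
    have e : ∀ t : Fin a, block d s a t = d (blockEmb h t) := fun t =>
      block_apply d t (blockEmb h t).2
    simp only [e, blockPerm_apply]

/-! ### From shuffles to all permutations -/

/-- `σ` is increasing on the block of `a` positions starting after `s` positions. -/
def IncrOn {n : ℕ} (σ : Equiv.Perm (Fin n)) (s a : ℕ) : Prop :=
  ∀ i j : Fin n, s ≤ i → i < j → (j : ℕ) < s + a → σ i < σ j

theorem IncrOn.strictMono {n s a : ℕ} (h : s + a ≤ n) {σ : Equiv.Perm (Fin n)}
    (hσ : IncrOn σ s a) : StrictMono (σ ∘ blockEmb h) := by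
  intro t t' htt'
  have := t'.2
  refine hσ _ _ ?_ ((blockEmb_lt_iff h).2 htt') ?_ <;> rw [blockEmb_val] <;> omega

theorem incrOn_of_strictMono {n s a : ℕ} (h : s + a ≤ n) {σ : Equiv.Perm (Fin n)}
    (hσ : StrictMono (σ ∘ blockEmb h)) : IncrOn σ s a := by
  intro i j hi hij hj
  obtain ⟨t, rfl⟩ := exists_blockEmb h i hi (by rw [Fin.lt_def] at hij; omega)
  obtain ⟨t', rfl⟩ := exists_blockEmb h j (by rw [Fin.lt_def] at hij; omega) hj
  exact hσ ((blockEmb_lt_iff h).1 hij)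

open Classical in
/-- Permutations that are increasing on a block represent the cosets of the group of permutations
of that block. -/
theorem sum_incrOn {V : Type*} [AddCommGroup V] {n s a : ℕ} (h : s + a ≤ n)
    (X : Finset (Equiv.Perm (Fin n))) (hX : ∀ σ τ, σ ∈ X → σ * blockPerm h τ ∈ X)
    (F : Equiv.Perm (Fin n) → V) (hF : ∀ σ τ, F (σ * blockPerm h τ) = F σ) :
    ∑ σ ∈ X, F σ = a.factorial • ∑ σ ∈ X with IncrOn σ s a, F σ := by
  have h1 : a.factorial • ∑ σ ∈ X with IncrOn σ s a, F σ =
      ∑ p ∈ (X.filter fun σ => IncrOn σ s a) ×ˢ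
        (univ : Finset (Equiv.Perm (Fin a))), F (p.1 * blockPerm h p.2) := by
    rw [sum_product]
    simp only [hF, sum_const, card_univ, Fintype.card_perm, Fintype.card_fin, smul_sum]
  have comp : ∀ (σ : Equiv.Perm (Fin n)) τ,
      (σ * blockPerm h τ : Equiv.Perm (Fin n)) ∘ blockEmb h = (σ ∘ blockEmb h) ∘ τ := by
    intro σ τ
    funext t
    simp [blockPerm_apply]
  rw [h1]
  symm
  refine Finset.sum_nbij (fun p => p.1 * blockPerm h p.2) ?_ ?_ ?_ (fun _ _ => rfl)
  · rintro ⟨σ, τ⟩ hp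
    simp only [mem_product, mem_filter, mem_univ, and_true] at hp ⊢
    exact hX _ _ hp.1
  · rintro ⟨σ, τ⟩ hp ⟨σ', τ'⟩ hp' heq
    simp only [coe_product, coe_filter, coe_univ, Set.mem_prod,
      Set.mem_ofPred_eq, Set.mem_univ, and_true] at hp hp' heq
    have hm := hp.2.strictMono h
    have hm' := hp'.2.strictMono h
    have e : σ' = σ * blockPerm h (τ * τ'⁻¹) := by
      rw [blockPerm_mul, ← mul_assoc, heq, mul_assoc, ← blockPerm_mul, mul_inv_cancel,
        blockPerm_one, mul_one]
    -- two permutations which make an injective tuple increasing are equal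
    have e1 : (σ ∘ blockEmb h) ∘ (τ * τ'⁻¹ : Equiv.Perm (Fin a)) =
        (σ ∘ blockEmb h) ∘ (1 : Equiv.Perm (Fin a)) := by
      refine Tuple.unique_monotone ?_ ?_
      · rw [← comp, ← e]
        exact hm'.monotone
      · exact hm.monotone
    have e2 : τ * τ'⁻¹ = 1 := by
      ext t
      have := hm.injective (congrFun e1 t)
      rw [this]
    have e3 : τ = τ' := mul_inv_eq_one.1 e2
    rw [e2, blockPerm_one, mul_one] at e
    rw [e, e3]
  · intro σ hσ
    rw [mem_coe] at hσ
    set τ := Tuple.sort (σ ∘ blockEmb h) with hτ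
    refine ⟨(σ * blockPerm h τ, τ⁻¹), ?_, ?_⟩
    · simp only [coe_product, coe_filter, coe_univ, Set.mem_prod,
        Set.mem_ofPred_eq, Set.mem_univ, and_true]
      refine ⟨hX _ _ hσ, incrOn_of_strictMono h ?_⟩
      rw [comp]
      refine (Tuple.monotone_sort _).strictMono_of_injective ?_
      exact (σ.injective.comp (blockEmb h).injective).comp τ.injective
    · simp only
      rw [mul_assoc, ← blockPerm_mul, mul_inv_cancel, blockPerm_one, mul_one]

theorem IncrOn.mul_blockPerm {n s a : ℕ} (h : s + a ≤ n) {σ : Equiv.Perm (Fin n)} {s' a' : ℕ}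
    (hσ : IncrOn σ s' a') (hd : s' + a' ≤ s ∨ s + a ≤ s') (τ : Equiv.Perm (Fin a)) :
    IncrOn (σ * blockPerm h τ) s' a' := by
  intro i j hi hij hj
  have hij' := Fin.lt_def.1 hij
  rw [Equiv.Perm.mul_apply, Equiv.Perm.mul_apply, blockPerm_apply_of_not_mem h τ i (by omega),
    blockPerm_apply_of_not_mem h τ j (by omega)]
  exact hσ i j hi hij hj

theorem mem_shuffles₂ {n a : ℕ} (h : a ≤ n) (σ : Equiv.Perm (Fin n)) :
    σ ∈ shuffles₂ n a ↔ IncrOn σ 0 a ∧ IncrOn σ a (n - a) := by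
  simp only [shuffles₂, mem_filter, mem_univ, true_and, IncrOn]
  constructor
  · intro hσ
    exact ⟨fun i j _ hij hj => hσ i j hij (by omega), fun i j hi hij _ => hσ i j hij (by omega)⟩
  · rintro ⟨h1, h2⟩ i j hij hj
    have := i.2
    have := j.2
    rcases hj with hj | hj
    · exact h1 i j (by omega) hij (by omega)
    · exact h2 i j (by omega) hij (by omega)

theorem mem_shuffles₃ {n a b : ℕ} (h : a + b ≤ n) (σ : Equiv.Perm (Fin n)) :
    σ ∈ shuffles₃ n a b ↔
      (IncrOn σ 0 a ∧ IncrOn σ a b) ∧ IncrOn σ (a + b) (n - a - b) := by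
  simp only [shuffles₃, mem_filter, mem_univ, true_and, IncrOn]
  constructor
  · intro hσ
    exact ⟨⟨fun i j _ hij hj => hσ i j hij (by omega), fun i j hi hij _ => hσ i j hij (by omega)⟩,
      fun i j hi hij _ => hσ i j hij (by omega)⟩
  · rintro ⟨⟨h1, h2⟩, h3⟩ i j hij hj
    have := i.2
    have := j.2
    rcases hj with hj | hj | hj
    · exact h1 i j (by omega) hij (by omega)
    · exact h2 i j (by omega) hij (by omega)
    · exact h3 i j (by omega) hij (by omega)

/-- The shuffles represent the cosets of `S_a × S_{n-a}` in `S_n`. -/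
theorem sum_shuffles₂ {V : Type*} [AddCommGroup V] {n a : ℕ} (h : a ≤ n)
    (F : Equiv.Perm (Fin n) → V)
    (h1 : ∀ σ τ, F (σ * blockPerm (s := 0) (a := a) (by omega) τ) = F σ)
    (h2 : ∀ σ τ, F (σ * blockPerm (s := a) (a := n - a) (by omega) τ) = F σ) :
    ∑ σ, F σ = (a.factorial * (n - a).factorial) • ∑ σ ∈ shuffles₂ n a, F σ := by
  classical
  have e0 := sum_incrOn (s := 0) (a := a) (by omega) univ (by simp) F h1
  have e1 := sum_incrOn (s := a) (a := n - a) (by omega) (univ.filter fun σ => IncrOn σ 0 a)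
    (fun σ τ hσ => by
      simp only [mem_filter, mem_univ, true_and] at hσ ⊢
      exact hσ.mul_blockPerm _ (by omega) τ) F h2
  rw [e0, e1, smul_smul]
  congr 2
  ext σ
  simp [mem_shuffles₂ h]

/-- The shuffles represent the cosets of `S_a × S_b × S_{n-a-b}` in `S_n`. -/
theorem sum_shuffles₃ {V : Type*} [AddCommGroup V] {n a b : ℕ} (h : a + b ≤ n)
    (F : Equiv.Perm (Fin n) → V)
    (h1 : ∀ σ τ, F (σ * blockPerm (s := 0) (a := a) (by omega) τ) = F σ)
    (h2 : ∀ σ τ, F (σ * blockPerm (s := a) (a := b) (by omega) τ) = F σ)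
    (h3 : ∀ σ τ, F (σ * blockPerm (s := a + b) (a := n - a - b) (by omega) τ) = F σ) :
    ∑ σ, F σ = (a.factorial * b.factorial * (n - a - b).factorial) •
      ∑ σ ∈ shuffles₃ n a b, F σ := by
  classical
  have e0 := sum_incrOn (s := 0) (a := a) (by omega) univ (by simp) F h1
  have e1 := sum_incrOn (s := a) (a := b) (by omega) (univ.filter fun σ => IncrOn σ 0 a)
    (fun σ τ hσ => by
      simp only [mem_filter, mem_univ, true_and] at hσ ⊢
      exact hσ.mul_blockPerm _ (by omega) τ) F h2
  have e2 := sum_incrOn (s := a + b) (a := n - a - b) (by omega)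
    ((univ.filter fun σ => IncrOn σ 0 a).filter fun σ => IncrOn σ a b)
    (fun σ τ hσ => by
      simp only [mem_filter, mem_univ, true_and] at hσ ⊢
      exact ⟨hσ.1.mul_blockPerm _ (by omega) τ, hσ.2.mul_blockPerm _ (by omega) τ⟩) F h3
  rw [e0, e1, e2, smul_smul, smul_smul]
  congr 2
  ext σ
  simp [mem_shuffles₃ h]

/-! ### Exchanging two neighbouring blocks -/

/-- The permutation with `(x₁, …, xₙ) ∘ σ = (x_{i+1}, …, x_{i+j}, x₁, …, x_i, x_{i+j+1}, …, xₙ)`. -/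
def blockRot {n i j : ℕ} (h : i + j ≤ n) : Equiv.Perm (Fin n) where
  toFun t := ⟨if (t : ℕ) < j then t + i else if (t : ℕ) < i + j then t - j else t, by
    split_ifs <;> omega⟩
  invFun t := ⟨if (t : ℕ) < i then t + j else if (t : ℕ) < i + j then t - i else t, by
    split_ifs <;> omega⟩
  left_inv t := by
    ext
    simp only
    split_ifs <;> omega
  right_inv t := by
    ext
    simp only
    split_ifs <;> omega

theorem blockRot_val {n i j : ℕ} (h : i + j ≤ n) (t : Fin n) :
    (blockRot h t : ℕ) = if (t : ℕ) < j then t + i else if (t : ℕ) < i + j then t - j else t :=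
  rfl

theorem block_comp_blockRot_left {α : Type*} [Zero α] {n i j : ℕ} (h : i + j ≤ n) (x : Fin n → α) :
    block (x ∘ blockRot h) 0 j = block x i j := by
  funext t
  have := t.2
  rw [block_apply _ _ (by omega), block_apply _ _ (by omega), Function.comp]
  congr 1
  ext
  rw [blockRot_val]
  simp only
  split_ifs <;> omega

/-- The first `i` elements are moved by `j` positions. -/
theorem block_comp_blockRot_mid {α : Type*} [Zero α] {n i j : ℕ} (h : i + j ≤ n) (x : Fin n → α)
    {s a : ℕ} (hs : s + a ≤ i) : block (x ∘ blockRot h) (j + s) a = block x s a := by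
  funext t
  have := t.2
  rw [block_apply _ _ (by omega), block_apply _ _ (by omega), Function.comp]
  congr 1
  ext
  rw [blockRot_val]
  simp only
  split_ifs <;> omega

theorem block_comp_blockRot_right {α : Type*} [Zero α] {n i j : ℕ} (h : i + j ≤ n) (x : Fin n → α)
    {s a : ℕ} (hs : i + j ≤ s) : block (x ∘ blockRot h) s a = block x s a := by
  funext t
  simp only [block]
  split_ifs with h'
  · rw [Function.comp]
    congr 1
    ext
    rw [blockRot_val]
    simp only
    split_ifs <;> omega
  · rfl

theorem negOnePow_sum {ι : Type*} (s : Finset ι) (f : ι → ℤ) :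
    Int.negOnePow (∑ i ∈ s, f i) = ∏ i ∈ s, Int.negOnePow (f i) := by
  classical
  induction s using Finset.induction_on with
  | empty => simp
  | insert a s ha ih => rw [sum_insert ha, prod_insert ha, Int.negOnePow_add, ih]

/-- The inverted pairs are those with one element in each of the two exchanged blocks. -/
theorem koszulSign_blockRot {n i j : ℕ} (h : i + j ≤ n) (d : Fin n → ℤ) :
    koszulSign (blockRot h) d =
      Int.negOnePow ((∑ t, block d 0 i t) * ∑ t, block d i j t) := by
  have e : ((∑ t, block d 0 i t) * ∑ t, block d i j t) =
      ∑ p : Fin j × Fin i, block d i j p.1 * block d 0 i p.2 := by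
    rw [mul_comm, sum_mul_sum, Fintype.sum_prod_type]
  rw [e, negOnePow_sum]
  symm
  refine Finset.prod_nbij
    (fun p => (⟨p.1, by omega⟩, ⟨j + p.2, by omega⟩)) ?_ ?_ ?_ ?_
  · rintro ⟨s, t⟩ -
    simp only [mem_filter, mem_univ, true_and, Fin.lt_def, blockRot_val]
    split_ifs <;> omega
  · rintro ⟨s, t⟩ - ⟨s', t'⟩ - hp
    simp only [Prod.mk.injEq, Fin.mk.injEq] at hp
    ext <;> simp only <;> omega
  · rintro ⟨s, t⟩ hp
    simp only [coe_filter, mem_univ, true_and, Set.mem_ofPred_eq, Fin.lt_def, blockRot_val] at hp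
    have h1 : (s : ℕ) < j ∧ j ≤ (t : ℕ) ∧ (t : ℕ) < i + j := by
      revert hp
      split_ifs <;> omega
    refine ⟨(⟨s, h1.1⟩, ⟨t - j, by omega⟩), by simp, ?_⟩
    ext
    · rfl
    · simp only; omega
  · rintro ⟨s, t⟩ -
    have hs := s.2
    have ht := t.2
    rw [block_apply _ _ (by omega), block_apply _ _ (by omega)]
    congr 3 <;> ext <;> simp only [blockRot_val] <;> split_ifs <;> omega

/-! ### Sorting permutations by the position of the first element -/

/-- Every permutation arises in a unique way by permuting the last `m` elements and then moving the
first element behind `p` others. -/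
theorem sum_blockPerm_mul_blockRot {W : Type*} [AddCommMonoid W] {m : ℕ}
    (F : Equiv.Perm (Fin (m + 1)) → W) :
    ∑ σ, F σ = ∑ p : Fin (m + 1), ∑ τ : Equiv.Perm (Fin m),
      F (blockPerm (s := 1) (a := m) (by omega) τ * blockRot (i := 1) (j := p) (by omega)) := by
  rw [← Fintype.sum_prod_type']
  symm
  have hzero : ∀ (p : Fin (m + 1)) (τ : Equiv.Perm (Fin m)),
      (blockPerm (s := 1) (a := m) (by omega) τ *
        blockRot (i := 1) (j := p) (by omega) : Equiv.Perm (Fin (m + 1))) p = 0 := by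
    intro p τ
    have h0 : blockRot (n := m + 1) (i := 1) (j := p) (by omega) p = 0 := by
      ext
      rw [blockRot_val]
      simp
    rw [Equiv.Perm.mul_apply, h0, blockPerm_apply_of_not_mem _ _ _ (by simp)]
  refine Function.Bijective.sum_comp
    (e := fun p : Fin (m + 1) × Equiv.Perm (Fin m) =>
      blockPerm (s := 1) (a := m) (by omega) p.2 * blockRot (i := 1) (j := p.1) (by omega)) ?_ F
  rw [Fintype.bijective_iff_injective_and_card]
  constructor
  · rintro ⟨p, τ⟩ ⟨p', τ'⟩ h
    dsimp only at h
    have hp : p = p' := by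
      have h1 := hzero p τ
      rw [h, ← hzero p' τ'] at h1
      exact (Equiv.injective _) h1
    subst hp
    rw [blockPerm_injective _ (mul_right_cancel h)]
  · simp [Fintype.card_perm, Nat.factorial_succ]

/-- Sorting the permutations of `{1, …, m + 1}` by the position of the first element, where only
the side of `j` on which this position lies matters. -/
theorem sum_perm_succ {W : Type*} [AddCommGroup W] {m j : ℕ} (hj : j ≤ m + 1)
    (F : Equiv.Perm (Fin (m + 1)) → W) (A B : Equiv.Perm (Fin m) → W)
    (hA : ∀ (p : ℕ) (hp : 1 + p ≤ m + 1), p < j → ∀ τ,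
      F (blockPerm (s := 1) (a := m) (by omega) τ * blockRot hp) = A τ)
    (hB : ∀ (p : ℕ) (hp : 1 + p ≤ m + 1), j ≤ p → ∀ τ,
      F (blockPerm (s := 1) (a := m) (by omega) τ * blockRot hp) = B τ) :
    ∑ σ, F σ = j • ∑ τ, A τ + (m + 1 - j) • ∑ τ, B τ := by
  have e : ∀ p : Fin (m + 1), ∑ τ : Equiv.Perm (Fin m),
      F (blockPerm (s := 1) (a := m) (by omega) τ * blockRot (i := 1) (j := p) (by omega)) =
      if (p : ℕ) < j then ∑ τ, A τ else ∑ τ, B τ := by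
    intro p
    split_ifs with h
    · exact sum_congr rfl fun τ _ => hA p (by omega) h τ
    · exact sum_congr rfl fun τ _ => hB p (by omega) (by omega) τ
  rw [sum_blockPerm_mul_blockRot, sum_congr rfl fun p _ => e p,
    Fin.sum_univ_eq_sum_range (fun p => if p < j then ∑ τ, A τ else ∑ τ, B τ),
    sum_ite, sum_const, sum_const]
  have c1 : (range (m + 1)).filter (fun p => p < j) = range j := by
    ext p
    simp only [mem_filter, mem_range]
    omega
  have c2 : (range (m + 1)).filter (fun p => ¬ p < j) = Ico j (m + 1) := by
    ext p
    simp only [mem_filter, mem_range, mem_Ico]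
    omega
  rw [c1, c2, card_range, Nat.card_Ico]

/-- Moving the first element within the first `j` positions only permutes these positions. -/
theorem blockRot_eq_blockPerm {n p j : ℕ} (h : 1 + p ≤ n) (hj : 0 + j ≤ n) (hp : 1 + p ≤ j) :
    blockRot h = blockPerm hj (blockRot hp) := by
  ext t
  rcases lt_or_ge (t : ℕ) j with ht | ht
  · obtain ⟨t, rfl⟩ := exists_blockEmb hj t (by omega) (by omega)
    rw [blockPerm_apply, blockEmb_val, blockRot_val, blockRot_val, blockEmb_val]
    simp
  · rw [blockPerm_apply_of_not_mem hj _ t (by omega), blockRot_val]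
    split_ifs <;> omega

/-- Moving the first element behind `p ≥ j` others amounts to moving it behind `j` others and then
permuting the block after the first `j` positions. -/
theorem blockRot_eq_mul_blockPerm {n p j a : ℕ} (h : 1 + p ≤ n) (hj : 1 + j ≤ n) (ha : j + a ≤ n)
    (hjp : j ≤ p) (hp : 1 + (p - j) ≤ a) :
    blockRot h = blockRot hj * blockPerm ha (blockRot hp) := by
  ext t
  rw [Equiv.Perm.mul_apply]
  by_cases ht : j ≤ (t : ℕ) ∧ (t : ℕ) < j + a
  · obtain ⟨t, rfl⟩ := exists_blockEmb ha t ht.1 ht.2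
    rw [blockPerm_apply, blockRot_val, blockRot_val, blockEmb_val, blockEmb_val, blockRot_val]
    split_ifs <;> omega
  · rw [blockPerm_apply_of_not_mem ha _ t (by omega), blockRot_val, blockRot_val]
    split_ifs <;> omega

/-! ### Prepending an element to a tuple -/

theorem block_prepend_succ {α : Type*} [Zero α] {n : ℕ} (v : α) (w : Fin n → α) (s a : ℕ) :
    block (prepend v w) (s + 1) a = block w s a := by
  funext t
  simp only [block]
  by_cases h : s + (t : ℕ) < n
  · have h' : s + 1 + (t : ℕ) < n + 1 := by omega
    rw [dif_pos h, dif_pos h']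
    have e : (⟨s + 1 + t, h'⟩ : Fin (n + 1)) = Fin.succ ⟨s + t, h⟩ := by
      ext; simp only [Fin.val_succ]; omega
    rw [e, prepend, Fin.cons_succ]
  · rw [dif_neg h, dif_neg (by omega)]

theorem block_prepend_one {α : Type*} [Zero α] {n : ℕ} (v : α) (w : Fin n → α) (a : ℕ) :
    block (prepend v w) 1 a = block w 0 a :=
  block_prepend_succ v w 0 a

theorem block_prepend_zero {α : Type*} [Zero α] {n : ℕ} (v : α) (w : Fin n → α) (a : ℕ) :
    block (prepend v w) 0 (a + 1) = prepend v (block w 0 a) := by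
  funext t
  refine Fin.cases ?_ (fun t => ?_) t
  · rw [block_apply _ _ (by simp)]
    rfl
  · rw [prepend, prepend, Fin.cons_succ, ← block_prepend_succ v w 0 a]
    simp only [block, Fin.val_succ, prepend]
    have e : 0 + 1 + (t : ℕ) = 0 + (t + 1) := by omega
    simp only [e]

theorem prepend_comp_blockPerm {α : Type*} {n : ℕ} (v : α) (w : Fin n → α)
    (h : 1 + n ≤ n + 1) (τ : Equiv.Perm (Fin n)) :
    prepend v w ∘ blockPerm h τ = prepend v (w ∘ τ) := by
  have e : ∀ t : Fin n, blockEmb h t = t.succ := by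
    intro t
    ext
    rw [blockEmb_val, Fin.val_succ]
    omega
  funext t
  refine Fin.cases ?_ (fun t => ?_) t
  · rw [Function.comp, blockPerm_apply_of_not_mem h τ 0 (by simp)]
    rfl
  · rw [Function.comp, ← e, blockPerm_apply, e, e]
    rfl

theorem koszulSign_blockPerm_prepend {n : ℕ} (e : ℤ) (d : Fin n → ℤ) (h : 1 + n ≤ n + 1)
    (τ : Equiv.Perm (Fin n)) : koszulSign (blockPerm h τ) (prepend e d) = koszulSign τ d := by
  rw [koszulSign_blockPerm, block_prepend_one, block_zero_self]

theorem block_prepend_comp_blockRot_left {α : Type*} [Zero α] {n j : ℕ} (v : α) (w : Fin n → α)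
    (h : 1 + j ≤ n + 1) : block (prepend v w ∘ blockRot h) 0 j = block w 0 j := by
  rw [block_comp_blockRot_left, block_prepend_one]

theorem block_prepend_comp_blockRot_right {α : Type*} [Zero α] {n j : ℕ} (v : α) (w : Fin n → α)
    (h : 1 + j ≤ n + 1) (b : ℕ) :
    block (prepend v w ∘ blockRot h) j (b + 1) = prepend v (block w j b) := by
  funext t
  refine Fin.cases ?_ (fun t => ?_) t
  · rw [block_apply _ _ (by simp; omega)]
    have e : blockRot h ⟨j + (0 : Fin (b + 1)), by simp; omega⟩ = 0 := by
      ext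
      rw [blockRot_val]
      simp
    rw [Function.comp, e]
    rfl
  · rw [prepend, prepend, Fin.cons_succ, ← block_prepend_succ v w j b,
      ← block_comp_blockRot_right h (prepend v w) (show 1 + j ≤ j + 1 by omega)]
    simp only [block, Fin.val_succ]
    have e : j + 1 + (t : ℕ) = j + (t + 1) := by omega
    simp only [e]
    rfl

theorem koszulSign_blockRot_prepend {n j : ℕ} (e : ℤ) (d : Fin n → ℤ) (h : 1 + j ≤ n + 1) :
    koszulSign (blockRot h) (prepend e d) = Int.negOnePow (e * ∑ t, block d 0 j t) := by
  rw [koszulSign_blockRot, block_prepend_one]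
  congr 2
  simp only [univ_unique, sum_singleton]
  rw [block_apply _ _ (by simp)]
  rfl

/-! ### Averaging over the permutations of a block -/

section Average

variable {V : Type*} [AddCommGroup V] {n : ℕ} (d : Fin n → ℤ)

/-- A signed sum over all permutations absorbs a signed sum over the permutations of a block. -/
theorem sum_koszulSign_smul_sum_blockPerm {s a : ℕ} (h : s + a ≤ n)
    (G : Equiv.Perm (Fin n) → V) :
    ∑ σ : Equiv.Perm (Fin n), koszulSign σ d •
        ∑ τ : Equiv.Perm (Fin a), koszulSign τ (block (d ∘ σ) s a) • G (σ * blockPerm h τ) =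
      a.factorial • ∑ σ, koszulSign σ d • G σ := by
  have e : ∀ (σ : Equiv.Perm (Fin n)) (τ : Equiv.Perm (Fin a)),
      koszulSign σ d • koszulSign τ (block (d ∘ σ) s a) • G (σ * blockPerm h τ) =
      koszulSign (σ * blockPerm h τ) d • G (σ * blockPerm h τ) := by
    intro σ τ
    rw [smul_smul, koszulSign_mul, koszulSign_blockPerm]
  simp only [smul_sum, e]
  rw [sum_comm]
  have e' : ∀ τ : Equiv.Perm (Fin a),
      ∑ σ, koszulSign (σ * blockPerm h τ) d • G (σ * blockPerm h τ) =
      ∑ σ, koszulSign σ d • G σ := fun τ =>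
    Equiv.sum_comp (Equiv.mulRight (blockPerm h τ)) fun σ => koszulSign σ d • G σ
  simp only [e', sum_const, card_univ, Fintype.card_perm, Fintype.card_fin, smul_sum]

/-- If `G` is graded symmetric in a block, then `σ ↦ ε(σ) G(σ)` is constant on the cosets of the
permutations of that block. -/
theorem koszulSign_smul_invariant {s a : ℕ} (h : s + a ≤ n) (G : Equiv.Perm (Fin n) → V)
    (σ : Equiv.Perm (Fin n)) (τ : Equiv.Perm (Fin a))
    (hG : G (σ * blockPerm h τ) = koszulSign τ (block (d ∘ σ) s a) • G σ) :
    koszulSign (σ * blockPerm h τ) d • G (σ * blockPerm h τ) = koszulSign σ d • G σ := by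
  rw [hG, koszulSign_mul, koszulSign_blockPerm, smul_smul, mul_assoc, koszulSign_mul_self, mul_one]

end Average

section Operations

variable {k V : Type*} [Field k] [AddCommGroup V] [Module k V] {𝒜 : ℤ → Submodule k V}

/-! ### Graded symmetry of monomials -/

theorem mon_comp_perm {n : ℕ} {d : Fin n → ℤ} {x : Fin n → V} (hx : ∀ i, x i ∈ 𝒜 (d i))
    (σ : Equiv.Perm (Fin n)) : mon 𝒜 n (x ∘ σ) = koszulSign σ d • mon 𝒜 n x := by
  have h : mon 𝒜 n x = koszulSign σ d • mon 𝒜 n (x ∘ σ) := by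
    rw [← sub_eq_zero]
    have h1 : PiTensorProduct.tprod k x -
        koszulSign σ d • PiTensorProduct.tprod k (fun i => x (σ i)) ∈ symRel 𝒜 n :=
      Submodule.subset_span ⟨d, x, σ, hx, rfl⟩
    have h2 := (Submodule.Quotient.mk_eq_zero (symRel 𝒜 n)).2 h1
    rw [← h2]
    rfl
  rw [h, smul_smul, koszulSign_mul_self, one_smul]

theorem mon₂_comp_perm_left {p q : ℕ} {d : Fin p → ℤ} {x : Fin p → V} (hx : ∀ i, x i ∈ 𝒜 (d i))
    (σ : Equiv.Perm (Fin p)) (y : Fin q → V) :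
    mon₂ 𝒜 𝒜 (x ∘ σ) y = koszulSign σ d • mon₂ 𝒜 𝒜 x y := by
  rw [mon₂, mon_comp_perm hx]
  rcases Int.units_eq_one_or (koszulSign σ d) with h | h <;> simp [h, mon₂, TensorProduct.neg_tmul]

theorem mon₂_comp_perm_right {p q : ℕ} {d : Fin q → ℤ} (x : Fin p → V) {y : Fin q → V}
    (hy : ∀ i, y i ∈ 𝒜 (d i)) (σ : Equiv.Perm (Fin q)) :
    mon₂ 𝒜 𝒜 x (y ∘ σ) = koszulSign σ d • mon₂ 𝒜 𝒜 x y := by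
  rw [mon₂, mon_comp_perm hy]
  rcases Int.units_eq_one_or (koszulSign σ d) with h | h <;> simp [h, mon₂, TensorProduct.tmul_neg]

theorem prepend_mem {n : ℕ} {e : ℤ} {v : V} (hv : v ∈ 𝒜 e) {d : Fin n → ℤ} {w : Fin n → V}
    (hw : ∀ i, w i ∈ 𝒜 (d i)) (i : Fin (n + 1)) : prepend v w i ∈ 𝒜 (prepend e d i) := by
  refine Fin.cases ?_ (fun t => ?_) i
  · exact hv
  · exact hw t

theorem mon₂_prepend_comp_left {p q : ℕ} {e : ℤ} {v : V} (hv : v ∈ 𝒜 e) {d : Fin p → ℤ}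
    {x : Fin p → V} (hx : ∀ i, x i ∈ 𝒜 (d i)) (σ : Equiv.Perm (Fin p)) (y : Fin q → V) :
    mon₂ 𝒜 𝒜 (prepend v (x ∘ σ)) y = koszulSign σ d • mon₂ 𝒜 𝒜 (prepend v x) y := by
  rw [← prepend_comp_blockPerm v x (by omega) σ, mon₂_comp_perm_left (prepend_mem hv hx),
    koszulSign_blockPerm_prepend]

theorem mon₂_prepend_comp_right {p q : ℕ} {e : ℤ} {v : V} (hv : v ∈ 𝒜 e) {d : Fin q → ℤ}
    (x : Fin p → V) {y : Fin q → V} (hy : ∀ i, y i ∈ 𝒜 (d i)) (σ : Equiv.Perm (Fin q)) :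
    mon₂ 𝒜 𝒜 x (prepend v (y ∘ σ)) = koszulSign σ d • mon₂ 𝒜 𝒜 x (prepend v y) := by
  rw [← prepend_comp_blockPerm v y (by omega) σ, mon₂_comp_perm_right x (prepend_mem hv hy),
    koszulSign_blockPerm_prepend]

/-- The linear map `v ↦ v w₁ ⋯ w_p ⊗ y₁ ⋯ y_q`. -/
def prependLeft (𝒜 : ℤ → Submodule k V) {p q : ℕ} (w : Fin p → V) (y : Fin q → V) :
    V →ₗ[k] GSym 𝒜 (p + 1) ⊗[k] GSym 𝒜 q where
  toFun v := mon₂ 𝒜 𝒜 (prepend v w) y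
  map_add' v v' := by
    simp only [mon₂, prepend, MultilinearMap.cons_add, TensorProduct.add_tmul]
  map_smul' c v := by
    simp only [mon₂, prepend, MultilinearMap.cons_smul, TensorProduct.smul_tmul', RingHom.id_apply]

/-- The linear map `v ↦ x₁ ⋯ x_p ⊗ v w₁ ⋯ w_q`. -/
def prependRight (𝒜 : ℤ → Submodule k V) {p q : ℕ} (x : Fin p → V) (w : Fin q → V) :
    V →ₗ[k] GSym 𝒜 p ⊗[k] GSym 𝒜 (q + 1) where
  toFun v := mon₂ 𝒜 𝒜 x (prepend v w)
  map_add' v v' := by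
    simp only [mon₂, prepend, MultilinearMap.cons_add, TensorProduct.tmul_add]
  map_smul' c v := by
    simp only [mon₂, prepend, MultilinearMap.cons_smul, TensorProduct.tmul_smul, RingHom.id_apply]

theorem prependRight_apply {p q : ℕ} (x : Fin p → V) (w : Fin q → V) (v : V) :
    prependRight 𝒜 x w v = mon₂ 𝒜 𝒜 x (prepend v w) := rfl

theorem map_sign_smul {V₁ V₂ : Type*} [AddCommGroup V₁] [Module k V₁] [AddCommGroup V₂]
    [Module k V₂] (f : V₁ →ₗ[k] V₂) (ε : ℤˣ) (v : V₁) : f (ε • v) = ε • f v := by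
  rcases Int.units_eq_one_or ε with h | h <;> simp [h]

theorem sign_smul_mem (W : Submodule k V) (ε : ℤˣ) {v : V} (hv : v ∈ W) : ε • v ∈ W := by
  rcases Int.units_eq_one_or ε with h | h <;> simp [h, hv]

theorem sign_smul_comm (ε : ℤˣ) (c : k) (v : V) : ε • c • v = c • ε • v := by
  rcases Int.units_eq_one_or ε with h | h <;> simp [h]

/-! ### Values of the operations on consecutive blocks -/

variable (R : ∀ p q : ℕ, GSym 𝒜 p ⊗[k] GSym 𝒜 q →ₗ[k] V)

/-- The element `R_{a,b}(x_{s+1} ⋯ x_{s+a} ⊗ x_{s+a+1} ⋯ x_{s+a+b})`. -/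
def opVal (a b : ℕ) {n : ℕ} (s : ℕ) (x : Fin n → V) : V :=
  R a b (mon₂ 𝒜 𝒜 (block x s a) (block x (s + a) b))

variable {R}

theorem opVal_block {n : ℕ} (x : Fin n → V) {s a b m s' : ℕ} (h : s' + (a + b) ≤ m) :
    opVal R a b s' (block x s m) = opVal R a b (s + s') x := by
  rw [opVal, block_block _ (by omega), block_block _ (by omega), opVal, add_assoc]

theorem sum_block_add {n : ℕ} (d : Fin n → ℤ) (s a b : ℕ) :
    ∑ t, block d s (a + b) t = ∑ t, block d s a t + ∑ t, block d (s + a) b t := by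
  rw [Fin.sum_univ_add]
  congr 1
  refine sum_congr rfl fun t _ => ?_
  simp only [block, Fin.val_natAdd, add_assoc]

theorem sum_block_comp {n : ℕ} (d : Fin n → ℤ) {s a : ℕ} (h : s + a ≤ n)
    (τ : Equiv.Perm (Fin a)) :
    ∑ t, block (d ∘ blockPerm h τ) s a t = ∑ t, block d s a t := by
  rw [block_comp_blockPerm]
  exact Equiv.sum_comp τ _

theorem opVal_mem (hdeg : ∀ p q, IsDegreeOne 𝒜 𝒜 (R p q)) {n : ℕ} {d : Fin n → ℤ} {x : Fin n → V}
    (hx : ∀ i, x i ∈ 𝒜 (d i)) (a b s : ℕ) :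
    opVal R a b s x ∈ 𝒜 (∑ t, block d s (a + b) t + 1) := by
  rw [sum_block_add]
  exact hdeg a b _ _ _ _ (block_mem hx _ _) (block_mem hx _ _)

theorem opVal_comp_left {n : ℕ} {d : Fin n → ℤ} {x : Fin n → V} (hx : ∀ i, x i ∈ 𝒜 (d i))
    {a s : ℕ} (b : ℕ) (h : s + a ≤ n) (τ : Equiv.Perm (Fin a)) :
    opVal R a b s (x ∘ blockPerm h τ) = koszulSign τ (block d s a) • opVal R a b s x := by
  rw [opVal, block_comp_blockPerm, block_comp_blockPerm_of_disjoint _ _ _ (by omega),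
    mon₂_comp_perm_left (block_mem hx _ _), map_sign_smul, opVal]

theorem opVal_comp_right {n : ℕ} {d : Fin n → ℤ} {x : Fin n → V} (hx : ∀ i, x i ∈ 𝒜 (d i))
    {a b s s' : ℕ} (hs : s + a = s') (h : s' + b ≤ n) (τ : Equiv.Perm (Fin b)) :
    opVal R a b s (x ∘ blockPerm h τ) = koszulSign τ (block d s' b) • opVal R a b s x := by
  subst hs
  rw [opVal, block_comp_blockPerm, block_comp_blockPerm_of_disjoint _ _ _ (by omega),
    mon₂_comp_perm_right _ (block_mem hx _ _), map_sign_smul, opVal]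

theorem opVal_comp_of_disjoint {n : ℕ} (x : Fin n → V) {a b s s' m : ℕ} (h : s' + m ≤ n)
    (hd : s + (a + b) ≤ s' ∨ s' + m ≤ s) (τ : Equiv.Perm (Fin m)) :
    opVal R a b s (x ∘ blockPerm h τ) = opVal R a b s x := by
  rw [opVal, block_comp_blockPerm_of_disjoint _ _ _ (by omega),
    block_comp_blockPerm_of_disjoint _ _ _ (by omega), opVal]

theorem comp_mem {n : ℕ} {d : Fin n → ℤ} {x : Fin n → V} (hx : ∀ i, x i ∈ 𝒜 (d i))
    (σ : Equiv.Perm (Fin n)) (i : Fin n) : (x ∘ σ) i ∈ 𝒜 ((d ∘ σ) i) := hx _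

/-! ### Shuffle sums as normalized sums over all permutations -/

/-- The scalar `1 / a!`. -/
def invFact (k : Type*) [Field k] (a : ℕ) : k := (a.factorial : k)⁻¹

variable [CharZero k]

theorem invFact_smul_factorial_smul (a : ℕ) (v : V) :
    invFact k a • a.factorial • v = v := by
  rw [← Nat.cast_smul_eq_nsmul k, smul_smul, invFact,
    inv_mul_cancel₀ (Nat.cast_ne_zero.2 a.factorial_ne_zero), one_smul]

theorem invFact_smul_sum_blockPerm {n : ℕ} (d : Fin n → ℤ) {s a : ℕ} (h : s + a ≤ n)
    (G : Equiv.Perm (Fin n) → V) :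
    invFact k a • ∑ σ : Equiv.Perm (Fin n), koszulSign σ d •
        ∑ τ : Equiv.Perm (Fin a), koszulSign τ (block (d ∘ σ) s a) • G (σ * blockPerm h τ) =
      ∑ σ, koszulSign σ d • G σ := by
  rw [sum_koszulSign_smul_sum_blockPerm, invFact_smul_factorial_smul]

theorem invFact_succ_smul (a : ℕ) (v : V) :
    invFact k (a + 1) • (a + 1) • v = invFact k a • v := by
  have h : ((a + 1 : ℕ) : k) ≠ 0 := Nat.cast_ne_zero.2 (Nat.succ_ne_zero a)
  rw [← Nat.cast_smul_eq_nsmul k, smul_smul, invFact, invFact, Nat.factorial_succ, Nat.cast_mul,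
    mul_inv, mul_right_comm, inv_mul_cancel₀ h, one_mul]

/-- The terms of a sum over shuffles depend only on the coset of the shuffle, so that in
characteristic zero the sum is a normalized sum over all permutations. -/
theorem sum_shuffles₂_eq {n a : ℕ} (h : a ≤ n) (F : Equiv.Perm (Fin n) → V)
    (h1 : ∀ σ τ, F (σ * blockPerm (s := 0) (a := a) (by omega) τ) = F σ)
    (h2 : ∀ σ τ, F (σ * blockPerm (s := a) (a := n - a) (by omega) τ) = F σ) :
    ∑ σ ∈ shuffles₂ n a, F σ = (invFact k a * invFact k (n - a)) • ∑ σ, F σ := by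
  rw [sum_shuffles₂ h F h1 h2, mul_smul, mul_smul, smul_comm (a.factorial),
    invFact_smul_factorial_smul, invFact_smul_factorial_smul]

theorem sum_shuffles₃_eq {n a b : ℕ} (h : a + b ≤ n) (F : Equiv.Perm (Fin n) → V)
    (h1 : ∀ σ τ, F (σ * blockPerm (s := 0) (a := a) (by omega) τ) = F σ)
    (h2 : ∀ σ τ, F (σ * blockPerm (s := a) (a := b) (by omega) τ) = F σ)
    (h3 : ∀ σ τ, F (σ * blockPerm (s := a + b) (a := n - a - b) (by omega) τ) = F σ) :
    ∑ σ ∈ shuffles₃ n a b, F σ =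
      (invFact k a * invFact k b * invFact k (n - a - b)) • ∑ σ, F σ := by
  rw [sum_shuffles₃ h F h1 h2 h3, mul_comm (a.factorial * b.factorial), mul_smul, mul_smul,
    mul_smul, mul_smul, invFact_smul_factorial_smul, smul_comm (a.factorial),
    invFact_smul_factorial_smul, invFact_smul_factorial_smul]

/-! ### The operations `l^C` as sums over all permutations -/

variable [DirectSum.Decomposition 𝒜]

/-- Because of `R_{n,0} = 0`, the sum may include the term with an empty second factor. -/
theorem subadjacent_eq_sum_perm (hR : ∀ p, R p 0 = 0) {n : ℕ} {d : Fin n → ℤ} {x : Fin n → V}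
    (hx : ∀ i, x i ∈ 𝒜 (d i)) :
    subadjacent 𝒜 R n x = ∑ p ∈ antidiagonal n, (invFact k p.1 * invFact k p.2) •
      ∑ σ : Equiv.Perm (Fin n), koszulSign σ d • opVal R p.1 p.2 0 (x ∘ σ) := by
  rw [subadjacent_apply 𝒜 R n d x hx,
    Finset.Nat.sum_antidiagonal_eq_sum_range_succ (fun a b => (invFact k a * invFact k b) •
      ∑ σ : Equiv.Perm (Fin n), koszulSign σ d • opVal R a b 0 (x ∘ σ)), sum_range_succ]
  have h0 : ∀ σ : Equiv.Perm (Fin n), opVal R n (n - n) 0 (x ∘ σ) = 0 := by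
    intro σ
    rw [Nat.sub_self, opVal, hR, LinearMap.zero_apply]
  simp only [h0, smul_zero, sum_const_zero, add_zero]
  refine sum_congr rfl fun j hj => ?_
  have hj' : j ≤ n := (mem_range.1 hj).le
  rw [← sum_shuffles₂_eq hj']
  · simp only [opVal, zero_add]
  · intro σ τ
    exact koszulSign_smul_invariant d _ (fun σ => opVal R j (n - j) 0 (x ∘ σ)) σ τ
      (opVal_comp_left (comp_mem hx σ) _ _ τ)
  · intro σ τ
    exact koszulSign_smul_invariant d _ (fun σ => opVal R j (n - j) 0 (x ∘ σ)) σ τ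
      (opVal_comp_right (comp_mem hx σ) (zero_add j) _ τ)

theorem subadjacent_mem (hR : ∀ p, R p 0 = 0) (hdeg : ∀ p q, IsDegreeOne 𝒜 𝒜 (R p q)) {n : ℕ}
    {d : Fin n → ℤ} {x : Fin n → V} (hx : ∀ i, x i ∈ 𝒜 (d i)) :
    subadjacent 𝒜 R n x ∈ 𝒜 (∑ i, d i + 1) := by
  rw [subadjacent_eq_sum_perm hR hx]
  refine sum_mem fun p hp => Submodule.smul_mem _ _ (sum_mem fun σ _ => sign_smul_mem _ _ ?_)
  have h := opVal_mem hdeg (comp_mem hx σ) p.1 p.2 0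
  rw [mem_antidiagonal.1 hp, block_zero_self] at h
  convert h using 3
  exact (Equiv.sum_comp σ d).symm

/-- Graded symmetry of `l^C`: the sum over all permutations is only reindexed. -/
theorem subadjacent_comp_perm (hR : ∀ p, R p 0 = 0) {n : ℕ}
    {d : Fin n → ℤ} {x : Fin n → V} (hx : ∀ i, x i ∈ 𝒜 (d i)) (σ : Equiv.Perm (Fin n)) :
    subadjacent 𝒜 R n (x ∘ σ) = koszulSign σ d • subadjacent 𝒜 R n x := by
  rw [subadjacent_eq_sum_perm hR hx, subadjacent_eq_sum_perm hR (comp_mem hx σ), smul_sum]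
  refine sum_congr rfl fun p _ => ?_
  rw [sign_smul_comm]
  congr 1
  rw [smul_sum, ← Equiv.sum_comp (Equiv.mulLeft σ)
    (fun τ => koszulSign σ d • koszulSign τ d • opVal R p.1 p.2 0 (x ∘ τ))]
  refine sum_congr rfl fun τ _ => ?_
  rw [Equiv.coe_mulLeft, koszulSign_mul, smul_smul, ← mul_assoc, koszulSign_mul_self, one_mul]
  rfl

/-- The operations `l^C` on a tuple `(v, w₁, …, w_m)`: the element `v` goes to the first or to the
second factor of `Sym ⊗ Sym`. -/
theorem subadjacent_prepend (hR : ∀ p, R p 0 = 0) {m : ℕ} {e : ℤ} {v : V} (hv : v ∈ 𝒜 e)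
    {d : Fin m → ℤ} {w : Fin m → V} (hw : ∀ i, w i ∈ 𝒜 (d i)) :
    subadjacent 𝒜 R (m + 1) (prepend v w) =
      ∑ p ∈ antidiagonal m, (invFact k p.1 * invFact k p.2) •
        ∑ τ : Equiv.Perm (Fin m), koszulSign τ d •
          (R (p.1 + 1) p.2
              (mon₂ 𝒜 𝒜 (prepend v (block (w ∘ τ) 0 p.1)) (block (w ∘ τ) p.1 p.2)) +
            Int.negOnePow (e * ∑ t, block (d ∘ τ) 0 p.1 t) •
              R p.1 (p.2 + 1)
                (mon₂ 𝒜 𝒜 (block (w ∘ τ) 0 p.1) (prepend v (block (w ∘ τ) p.1 p.2)))) := by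
  -- `v` in the first factor, in front of the first `a` of the elements `w`; or in the second one
  set A : ℕ → ℕ → Equiv.Perm (Fin m) → V := fun a b τ => koszulSign τ d •
    R (a + 1) b (mon₂ 𝒜 𝒜 (prepend v (block (w ∘ τ) 0 a)) (block (w ∘ τ) a b)) with hAdef
  set B : ℕ → ℕ → Equiv.Perm (Fin m) → V := fun a b τ => koszulSign τ d •
    Int.negOnePow (e * ∑ t, block (d ∘ τ) 0 a t) •
      R a (b + 1) (mon₂ 𝒜 𝒜 (block (w ∘ τ) 0 a) (prepend v (block (w ∘ τ) a b))) with hBdef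
  have hX := prepend_mem hv hw
  have key : ∀ p ∈ antidiagonal (m + 1), ∑ σ : Equiv.Perm (Fin (m + 1)),
      koszulSign σ (prepend e d) • opVal R p.1 p.2 0 (prepend v w ∘ σ) =
      p.1 • ∑ τ, A (p.1 - 1) p.2 τ + p.2 • ∑ τ, B p.1 (p.2 - 1) τ := by
    rintro ⟨a, b⟩ hp
    have hab : a + b = m + 1 := mem_antidiagonal.1 hp
    dsimp only
    have hb : b = m + 1 - a := by omega
    set F : Equiv.Perm (Fin (m + 1)) → V := fun σ =>
      koszulSign σ (prepend e d) • opVal R a b 0 (prepend v w ∘ σ) with hF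
    have inv1 : ∀ (h : 0 + a ≤ m + 1) σ τ, F (σ * blockPerm h τ) = F σ := fun h σ τ =>
      koszulSign_smul_invariant _ _ (fun σ => opVal R a b 0 (prepend v w ∘ σ)) σ τ
        (opVal_comp_left (comp_mem hX σ) _ _ τ)
    have inv2 : ∀ (h : a + b ≤ m + 1) σ τ, F (σ * blockPerm h τ) = F σ := fun h σ τ =>
      koszulSign_smul_invariant _ _ (fun σ => opVal R a b 0 (prepend v w ∘ σ)) σ τ
        (opVal_comp_right (comp_mem hX σ) (zero_add a) _ τ)
    have e := sum_perm_succ (j := a) (by omega) F (A (a - 1) b) (B a (b - 1)) ?_ ?_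
    · rwa [← hb] at e
    · intro p hp' hpa τ
      obtain ⟨a, rfl⟩ : ∃ a', a = a' + 1 := ⟨a - 1, by omega⟩
      rw [blockRot_eq_blockPerm hp' (j := a + 1) (by omega) (by omega), inv1]
      simp only [hF, hAdef]
      rw [koszulSign_blockPerm_prepend, prepend_comp_blockPerm, opVal, zero_add,
        block_prepend_zero, block_prepend_succ, Nat.add_sub_cancel]
    · intro p hp' hpa τ
      obtain ⟨b, rfl⟩ : ∃ b', b = b' + 1 := ⟨b - 1, by omega⟩
      rw [blockRot_eq_mul_blockPerm hp' (j := a) (a := b + 1) (by omega) (by omega) hpa (by omega),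
        ← mul_assoc, inv2]
      simp only [hF, hBdef]
      rw [koszulSign_mul, koszulSign_blockPerm_prepend, prepend_comp_blockPerm,
        koszulSign_blockRot_prepend, Equiv.Perm.coe_mul, ← Function.comp_assoc,
        prepend_comp_blockPerm, opVal, zero_add, block_prepend_comp_blockRot_left,
        block_prepend_comp_blockRot_right, mul_smul, Nat.add_sub_cancel]
  rw [subadjacent_eq_sum_perm hR hX, sum_congr rfl fun p hp => by rw [key p hp, smul_add],
    sum_add_distrib]
  simp only [smul_add, sum_add_distrib]
  congr 1
  · rw [Finset.Nat.sum_antidiagonal_succ]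
    simp only [zero_smul, smul_zero, zero_add, Nat.add_sub_cancel]
    refine sum_congr rfl fun p _ => ?_
    rw [mul_comm, mul_smul, invFact_succ_smul, smul_smul, mul_comm]
  · rw [Finset.Nat.sum_antidiagonal_succ']
    simp only [zero_smul, smul_zero, zero_add, Nat.add_sub_cancel]
    refine sum_congr rfl fun p _ => ?_
    rw [mul_smul, invFact_succ_smul, smul_smul]

end Operations

/-! ### Reindexing sums over decompositions of natural numbers -/

section Antidiagonal

variable {W : Type*} [AddCommMonoid W]

theorem sum_range_Icc_eq_sum_antidiagonal {n : ℕ} (f : ℕ → ℕ → ℕ → W) (hf : ∀ a c, f a 0 c = 0) :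
    ∑ j ∈ range n, ∑ i ∈ Icc 1 (n - j), f j i (n - j - i) =
      ∑ p ∈ antidiagonal n, ∑ q ∈ antidiagonal p.1, f q.1 q.2 p.2 := by
  rw [sum_sigma', sum_sigma']
  symm
  refine sum_bij_ne_zero (fun x _ _ => ⟨x.2.1, x.2.2⟩) ?_ ?_ ?_ ?_
  · rintro ⟨⟨p, c⟩, ⟨a, b⟩⟩ h h0
    simp only [mem_sigma, HasAntidiagonal.mem_antidiagonal, mem_range, mem_Icc] at h ⊢
    rcases Nat.eq_zero_or_pos b with rfl | hb
    · exact absurd (hf _ _) h0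
    · omega
  · rintro ⟨⟨p, c⟩, ⟨a, b⟩⟩ h h0 ⟨⟨p', c'⟩, ⟨a', b'⟩⟩ h' h0' e
    simp only [mem_sigma, HasAntidiagonal.mem_antidiagonal] at h h'
    simp only [Sigma.mk.injEq, heq_eq_eq] at e
    obtain ⟨rfl, rfl⟩ := e
    obtain rfl : p = p' := by omega
    obtain rfl : c = c' := by omega
    rfl
  · rintro ⟨j, i⟩ h h0
    simp only [mem_sigma, mem_range, mem_Icc] at h
    refine ⟨⟨(j + i, n - j - i), (j, i)⟩, ?_, h0, rfl⟩
    simp only [mem_sigma, HasAntidiagonal.mem_antidiagonal, and_true]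
    omega
  · rintro ⟨⟨p, c⟩, ⟨a, b⟩⟩ h h0
    simp only [mem_sigma, HasAntidiagonal.mem_antidiagonal] at h
    obtain rfl : c = n - a - b := by omega
    rfl

theorem sum_Icc_eq_sum_antidiagonal {n : ℕ} (f : ℕ → ℕ → W) (hf : f 0 n = 0) :
    ∑ i ∈ Icc 1 n, f i (n - i) = ∑ p ∈ antidiagonal n, f p.1 p.2 := by
  rw [Finset.Nat.sum_antidiagonal_eq_sum_range_succ f]
  refine sum_subset (fun i hi => ?_) (fun i hi hi' => ?_)
  · simp only [mem_Icc, mem_range] at hi ⊢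
    omega
  · simp only [mem_Icc, mem_range] at hi hi'
    obtain rfl : i = 0 := by omega
    exact hf

/-- Sums over all decompositions `n = a + b + c + e`, bracketed as `((a + b) + c) + e` and as
`(a + b) + (c + e)`. -/
theorem sum_antidiagonal_left_eq (f : ℕ → ℕ → ℕ → ℕ → W) (n : ℕ) :
    ∑ p ∈ antidiagonal n, ∑ r ∈ antidiagonal p.1, ∑ q ∈ antidiagonal r.1, f q.1 q.2 r.2 p.2 =
      ∑ p ∈ antidiagonal n, ∑ q ∈ antidiagonal p.1, ∑ s ∈ antidiagonal p.2, f q.1 q.2 s.1 s.2 := by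
  simp only [sum_sigma']
  refine sum_nbij' (fun x => ⟨(x.2.1.1, x.2.1.2 + x.1.2), x.2.2, (x.2.1.2, x.1.2)⟩)
    (fun x => ⟨(x.1.1 + x.2.2.1, x.2.2.2), (x.1.1, x.2.2.1), x.2.1⟩) ?_ ?_ ?_ ?_ ?_
  · rintro ⟨⟨p, e⟩, ⟨r, c⟩, ⟨a, b⟩⟩ h
    simp only [mem_sigma, HasAntidiagonal.mem_antidiagonal, and_true] at h ⊢
    omega
  · rintro ⟨⟨p, r⟩, ⟨a, b⟩, ⟨c, e⟩⟩ h
    simp only [mem_sigma, HasAntidiagonal.mem_antidiagonal, true_and] at h ⊢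
    omega
  · rintro ⟨⟨p, e⟩, ⟨r, c⟩, ⟨a, b⟩⟩ h
    simp only [mem_sigma, HasAntidiagonal.mem_antidiagonal] at h
    obtain ⟨h1, rfl, h3⟩ := h
    rfl
  · rintro ⟨⟨p, r⟩, ⟨a, b⟩, ⟨c, e⟩⟩ h
    simp only [mem_sigma, HasAntidiagonal.mem_antidiagonal] at h
    obtain ⟨h1, h2, rfl⟩ := h
    rfl
  · intros
    rfl

/-- Sums over all decompositions `n = c + a + b + e`, bracketed as `(c + a) + (b + e)` and as
`(a + b) + (c + e)`. -/
theorem sum_antidiagonal_mid_eq (f : ℕ → ℕ → ℕ → ℕ → W) (n : ℕ) :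
    ∑ p ∈ antidiagonal n, ∑ q ∈ antidiagonal p.1, ∑ s ∈ antidiagonal p.2, f q.1 q.2 s.1 s.2 =
      ∑ p ∈ antidiagonal n, ∑ q ∈ antidiagonal p.1, ∑ s ∈ antidiagonal p.2,
        f s.1 q.1 q.2 s.2 := by
  simp only [sum_sigma']
  refine sum_nbij'
    (fun x => ⟨(x.2.1.2 + x.2.2.1, x.2.1.1 + x.2.2.2), (x.2.1.2, x.2.2.1), (x.2.1.1, x.2.2.2)⟩)
    (fun x => ⟨(x.2.2.1 + x.2.1.1, x.2.1.2 + x.2.2.2), (x.2.2.1, x.2.1.1), (x.2.1.2, x.2.2.2)⟩)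
    ?_ ?_ ?_ ?_ ?_
  · rintro ⟨⟨p, r⟩, ⟨a, b⟩, ⟨c, e⟩⟩ h
    simp only [mem_sigma, HasAntidiagonal.mem_antidiagonal, and_true] at h ⊢
    omega
  · rintro ⟨⟨p, r⟩, ⟨a, b⟩, ⟨c, e⟩⟩ h
    simp only [mem_sigma, HasAntidiagonal.mem_antidiagonal, and_true] at h ⊢
    omega
  · rintro ⟨⟨p, r⟩, ⟨a, b⟩, ⟨c, e⟩⟩ h
    simp only [mem_sigma, HasAntidiagonal.mem_antidiagonal] at h
    obtain ⟨h1, rfl, rfl⟩ := h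
    rfl
  · rintro ⟨⟨p, r⟩, ⟨a, b⟩, ⟨c, e⟩⟩ h
    simp only [mem_sigma, HasAntidiagonal.mem_antidiagonal] at h
    obtain ⟨h1, rfl, rfl⟩ := h
    rfl
  · intros
    rfl

end Antidiagonal

section Nested

variable {k V : Type*} [Field k] [AddCommGroup V] [Module k V] {𝒜 : ℤ → Submodule k V}
  {R : ∀ p q : ℕ, GSym 𝒜 p ⊗[k] GSym 𝒜 q →ₗ[k] V}

theorem sum_sign_smul_sum_smul {ι κ : Type*} (s : Finset κ) (ε : κ → ℤˣ) (S : Finset ι) (c : ι → k)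
    (X : ι → κ → V) :
    ∑ σ ∈ s, ε σ • ∑ i ∈ S, c i • X i σ = ∑ i ∈ S, c i • ∑ σ ∈ s, ε σ • X i σ := by
  simp only [smul_sum, sign_smul_comm]
  exact sum_comm

/-! ### Sums with one operation inside another one -/

/-- The sum over all permutations of the terms in which an operation, applied to two blocks of
sizes `a`, `b`, is inserted together with a third block of size `c` into an operation `Ψ`. -/
def leftNestSum (R : ∀ p q : ℕ, GSym 𝒜 p ⊗[k] GSym 𝒜 q →ₗ[k] V)
    (Ψ : ∀ c : ℕ, (Fin c → V) → V →ₗ[k] V) {n : ℕ} (d : Fin n → ℤ) (x : Fin n → V)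
    (a b c : ℕ) : V :=
  ∑ σ : Equiv.Perm (Fin n), koszulSign σ d •
    Ψ c (block (x ∘ σ) (a + b) c) (opVal R a b 0 (x ∘ σ))

variable [CharZero k]

/-- Sums over shuffles of three blocks, the first two being inserted into an inner operation. -/
theorem sum_shuffles₃_eq_leftNestSum (hR : ∀ p, R p 0 = 0)
    (hdeg : ∀ p q, IsDegreeOne 𝒜 𝒜 (R p q)) (Ψ : ∀ c : ℕ, (Fin c → V) → V →ₗ[k] V)
    (hΨ : ∀ (c : ℕ) (e : ℤ) (d : Fin c → ℤ) (v : V) (w : Fin c → V), v ∈ 𝒜 e →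
      (∀ i, w i ∈ 𝒜 (d i)) → ∀ τ : Equiv.Perm (Fin c), Ψ c (w ∘ τ) v = koszulSign τ d • Ψ c w v)
    {n : ℕ} {d : Fin n → ℤ} {x : Fin n → V} (hx : ∀ i, x i ∈ 𝒜 (d i)) :
    ∑ j ∈ range n, ∑ i ∈ Icc 1 (n - j), ∑ σ ∈ shuffles₃ n j i, koszulSign σ d •
        Ψ (n - j - i) (block (x ∘ σ) (j + i) (n - j - i)) (opVal R j i 0 (x ∘ σ)) =
      ∑ p ∈ antidiagonal n, ∑ q ∈ antidiagonal p.1,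
        (invFact k q.1 * invFact k q.2 * invFact k p.2) •
          leftNestSum R Ψ d x q.1 q.2 p.2 := by
  rw [← sum_range_Icc_eq_sum_antidiagonal (fun a b c =>
    (invFact k a * invFact k b * invFact k c) • leftNestSum R Ψ d x a b c)]
  · refine sum_congr rfl fun j hj => sum_congr rfl fun i hi => ?_
    simp only [mem_range, mem_Icc] at hj hi
    rw [leftNestSum, ← sum_shuffles₃_eq (by omega)]
    all_goals
      intro σ τ
      refine koszulSign_smul_invariant d _ (fun σ => Ψ (n - j - i)
        (block (x ∘ σ) (j + i) (n - j - i)) (opVal R j i 0 (x ∘ σ))) σ τ ?_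
      simp only [Equiv.Perm.coe_mul, ← Function.comp_assoc]
    · rw [block_comp_blockPerm_of_disjoint _ _ _ (by omega), opVal_comp_left (comp_mem hx σ),
        map_sign_smul]
    · rw [block_comp_blockPerm_of_disjoint _ _ _ (by omega),
        opVal_comp_right (comp_mem hx σ) (zero_add j), map_sign_smul]
    · rw [block_comp_blockPerm, opVal_comp_of_disjoint _ _ (by omega),
        hΨ _ _ _ _ _ (opVal_mem hdeg (comp_mem hx σ) _ _ _) (block_mem (comp_mem hx σ) _ _)]
  · intro a c
    simp only [leftNestSum, opVal, hR, LinearMap.zero_apply, map_zero, smul_zero, sum_const_zero]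

variable [DirectSum.Decomposition 𝒜]

/-- Sums over shuffles of two blocks, the first one being inserted into an operation `l^C`. -/
theorem sum_shuffles₂_eq_leftNestSum (hR : ∀ p, R p 0 = 0)
    (hdeg : ∀ p q, IsDegreeOne 𝒜 𝒜 (R p q)) (Ψ : ∀ c : ℕ, (Fin c → V) → V →ₗ[k] V)
    (hΨ : ∀ (c : ℕ) (e : ℤ) (d : Fin c → ℤ) (v : V) (w : Fin c → V), v ∈ 𝒜 e →
      (∀ i, w i ∈ 𝒜 (d i)) → ∀ τ : Equiv.Perm (Fin c), Ψ c (w ∘ τ) v = koszulSign τ d • Ψ c w v)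
    {n : ℕ} {d : Fin n → ℤ} {x : Fin n → V} (hx : ∀ i, x i ∈ 𝒜 (d i)) :
    ∑ i ∈ Icc 1 n, ∑ σ ∈ shuffles₂ n i, koszulSign σ d •
        Ψ (n - i) (block (x ∘ σ) i (n - i)) (subadjacent 𝒜 R i (block (x ∘ σ) 0 i)) =
      ∑ p ∈ antidiagonal n, ∑ q ∈ antidiagonal p.1,
        (invFact k q.1 * invFact k q.2 * invFact k p.2) •
          leftNestSum R Ψ d x q.1 q.2 p.2 := by
  set S : ℕ → ℕ → V := fun i c => (invFact k i * invFact k c) • ∑ σ : Equiv.Perm (Fin n),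
    koszulSign σ d • Ψ c (block (x ∘ σ) i c) (subadjacent 𝒜 R i (block (x ∘ σ) 0 i)) with hS
  have h1 : ∑ i ∈ Icc 1 n, ∑ σ ∈ shuffles₂ n i, koszulSign σ d •
        Ψ (n - i) (block (x ∘ σ) i (n - i)) (subadjacent 𝒜 R i (block (x ∘ σ) 0 i)) =
      ∑ i ∈ Icc 1 n, S i (n - i) := by
    refine sum_congr rfl fun i hi => ?_
    rw [mem_Icc] at hi
    rw [hS]
    dsimp only
    rw [← sum_shuffles₂_eq (by omega)]
    all_goals
      intro σ τ
      refine koszulSign_smul_invariant d _ (fun σ => Ψ (n - i) (block (x ∘ σ) i (n - i))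
        (subadjacent 𝒜 R i (block (x ∘ σ) 0 i))) σ τ ?_
      simp only [Equiv.Perm.coe_mul, ← Function.comp_assoc]
    · rw [block_comp_blockPerm_of_disjoint _ _ _ (by omega), block_comp_blockPerm,
        subadjacent_comp_perm hR (block_mem (comp_mem hx σ) _ _), map_sign_smul]
    · rw [block_comp_blockPerm_of_disjoint _ _ (s' := 0) _ (by omega), block_comp_blockPerm,
        hΨ _ _ _ _ _ (subadjacent_mem hR hdeg (block_mem (comp_mem hx σ) 0 i))
          (block_mem (comp_mem hx σ) _ _)]
  have h0 : ∀ y : Fin 0 → V, subadjacent 𝒜 R 0 y = 0 := by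
    intro y
    rw [subadjacent_apply 𝒜 R 0 (fun _ => 0) y (fun i => i.elim0)]
    simp
  rw [h1, sum_Icc_eq_sum_antidiagonal S]
  · refine sum_congr rfl fun p hp => ?_
    rw [HasAntidiagonal.mem_antidiagonal] at hp
    have h2 : ∀ σ : Equiv.Perm (Fin n), Ψ p.2 (block (x ∘ σ) p.1 p.2)
        (subadjacent 𝒜 R p.1 (block (x ∘ σ) 0 p.1)) =
        ∑ q ∈ antidiagonal p.1, (invFact k q.1 * invFact k q.2) •
          ∑ τ : Equiv.Perm (Fin p.1), koszulSign τ (block (d ∘ σ) 0 p.1) •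
            Ψ p.2 (block (x ∘ (σ * blockPerm (s := 0) (a := p.1) (by omega) τ :
                Equiv.Perm (Fin n))) (q.1 + q.2) p.2)
              (opVal R q.1 q.2 0 (x ∘ (σ * blockPerm (s := 0) (a := p.1) (by omega) τ :
                Equiv.Perm (Fin n)))) := by
      intro σ
      rw [subadjacent_eq_sum_perm hR (block_mem (comp_mem hx σ) _ _), map_sum]
      refine sum_congr rfl fun q hq => ?_
      rw [HasAntidiagonal.mem_antidiagonal] at hq
      rw [map_smul, map_sum]
      congr 1
      refine sum_congr rfl fun τ _ => ?_
      rw [map_sign_smul, Equiv.Perm.coe_mul, ← Function.comp_assoc,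
        block_comp_blockPerm_of_disjoint _ _ _ (by omega), ← block_comp_blockPerm (by omega),
        opVal_block _ (by omega), hq]
    simp only [hS, h2]
    rw [sum_sign_smul_sum_smul, smul_sum]
    refine sum_congr rfl fun q hq => ?_
    rw [smul_smul, show invFact k p.1 * invFact k p.2 * (invFact k q.1 * invFact k q.2) =
      invFact k q.1 * invFact k q.2 * invFact k p.2 * invFact k p.1 by ring, mul_smul,
      invFact_smul_sum_blockPerm d (s := 0) (a := p.1) (by omega)
      (fun σ => Ψ p.2 (block (x ∘ σ) (q.1 + q.2) p.2) (opVal R q.1 q.2 0 (x ∘ σ))), leftNestSum]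
  · simp only [hS, h0, map_zero, smul_zero, sum_const_zero]

end Nested

section Right

variable {k V : Type*} [Field k] [AddCommGroup V] [Module k V] {𝒜 : ℤ → Submodule k V}
  {R : ∀ p q : ℕ, GSym 𝒜 p ⊗[k] GSym 𝒜 q →ₗ[k] V}

/-! ### The Maurer–Cartan expression -/

/-- The value of an operation with another operation, which takes its first `a` arguments from `x`
and the other `b` ones from `y`, inserted into the second factor of `Sym ⊗ Sym`. -/
def rightNest (R : ∀ p q : ℕ, GSym 𝒜 p ⊗[k] GSym 𝒜 q →ₗ[k] V) (c a b e : ℕ) {n m : ℕ}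
    (x : Fin n → V) (y : Fin m → V) : V :=
  R c (e + 1) (mon₂ 𝒜 𝒜 (block x 0 c)
    (prepend (R a b (mon₂ 𝒜 𝒜 (block x c a) (block y 0 b))) (block y b e)))

theorem headSign_eq {n : ℕ} (d : Fin n → ℤ) (c : ℕ) :
    headSign d c = Int.negOnePow (∑ t, block d 0 c t) := rfl

theorem rightNest_zero (hR : ∀ p, R p 0 = 0) (c a e : ℕ) {n m : ℕ} (x : Fin n → V)
    (y : Fin m → V) : rightNest R c a 0 e x y = 0 := by
  rw [rightNest, hR, LinearMap.zero_apply, ← prependRight_apply, map_zero, map_zero]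

theorem rightNest_comp_left_fst {n m : ℕ} {d : Fin n → ℤ} {x : Fin n → V}
    (hx : ∀ i, x i ∈ 𝒜 (d i)) (y : Fin m → V) {c : ℕ} (a b e : ℕ) (h : 0 + c ≤ n)
    (σ : Equiv.Perm (Fin c)) :
    rightNest R c a b e (x ∘ blockPerm h σ) y =
      koszulSign σ (block d 0 c) • rightNest R c a b e x y := by
  rw [rightNest, block_comp_blockPerm, block_comp_blockPerm_of_disjoint _ _ _ (by omega),
    mon₂_comp_perm_left (block_mem hx _ _), map_sign_smul, rightNest]

theorem rightNest_comp_left_snd {n m : ℕ} {d : Fin n → ℤ} {x : Fin n → V}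
    (hx : ∀ i, x i ∈ 𝒜 (d i)) (y : Fin m → V) {c a : ℕ} (b e : ℕ) (h : c + a ≤ n)
    (σ : Equiv.Perm (Fin a)) :
    rightNest R c a b e (x ∘ blockPerm h σ) y =
      koszulSign σ (block d c a) • rightNest R c a b e x y := by
  rw [rightNest, block_comp_blockPerm, block_comp_blockPerm_of_disjoint _ _ _ (by omega),
    mon₂_comp_perm_left (block_mem hx _ _), map_sign_smul, ← prependRight_apply, map_sign_smul,
    map_sign_smul, rightNest, prependRight_apply]

theorem rightNest_comp_right_fst {n m : ℕ} {d : Fin m → ℤ} (x : Fin n → V) {y : Fin m → V}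
    (hy : ∀ i, y i ∈ 𝒜 (d i)) (c a : ℕ) {b : ℕ} (e : ℕ) (h : 0 + b ≤ m)
    (σ : Equiv.Perm (Fin b)) :
    rightNest R c a b e x (y ∘ blockPerm h σ) =
      koszulSign σ (block d 0 b) • rightNest R c a b e x y := by
  rw [rightNest, block_comp_blockPerm, block_comp_blockPerm_of_disjoint _ _ _ (by omega),
    mon₂_comp_perm_right _ (block_mem hy _ _), map_sign_smul, ← prependRight_apply, map_sign_smul,
    map_sign_smul, rightNest, prependRight_apply]

theorem rightNest_comp_right_snd (hdeg : ∀ p q, IsDegreeOne 𝒜 𝒜 (R p q)) {n m : ℕ}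
    {d : Fin n → ℤ} {d' : Fin m → ℤ} {x : Fin n → V} {y : Fin m → V} (hx : ∀ i, x i ∈ 𝒜 (d i))
    (hy : ∀ i, y i ∈ 𝒜 (d' i)) (c a : ℕ) {b e : ℕ} (h : b + e ≤ m) (σ : Equiv.Perm (Fin e)) :
    rightNest R c a b e x (y ∘ blockPerm h σ) =
      koszulSign σ (block d' b e) • rightNest R c a b e x y := by
  rw [rightNest, block_comp_blockPerm, block_comp_blockPerm_of_disjoint _ _ _ (by omega),
    mon₂_prepend_comp_right (hdeg _ _ _ _ _ _ (block_mem hx c a) (block_mem hy 0 b)) _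
      (block_mem hy _ _), map_sign_smul, rightNest]

/-- The sum over all permutations of the terms `rightNest` with their signs. -/
def rightNestSum (R : ∀ p q : ℕ, GSym 𝒜 p ⊗[k] GSym 𝒜 q →ₗ[k] V) {n m : ℕ} (d : Fin n → ℤ)
    (d' : Fin m → ℤ) (x : Fin n → V) (y : Fin m → V) (c a b e : ℕ) : V :=
  ∑ σ : Equiv.Perm (Fin n), koszulSign σ d • headSign (d ∘ σ) c •
    ∑ τ : Equiv.Perm (Fin m), koszulSign τ d' • rightNest R c a b e (x ∘ σ) (y ∘ τ)

/-- The linear map `v ↦ R_{c+1,m}(v w₁ ⋯ w_c ⊗ y₁ ⋯ y_m)`. -/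
def insertLeft (R : ∀ p q : ℕ, GSym 𝒜 p ⊗[k] GSym 𝒜 q →ₗ[k] V) {m : ℕ} (y : Fin m → V) (c : ℕ)
    (w : Fin c → V) : V →ₗ[k] V :=
  R (c + 1) m ∘ₗ prependLeft 𝒜 w y

theorem insertLeft_apply {m : ℕ} (y : Fin m → V) (c : ℕ) (w : Fin c → V) (v : V) :
    insertLeft R y c w v = R (c + 1) m (mon₂ 𝒜 𝒜 (prepend v w) y) := rfl

theorem insertLeft_comp_perm {m : ℕ} (y : Fin m → V) (c : ℕ) (e : ℤ) (d : Fin c → ℤ) (v : V)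
    (w : Fin c → V) (hv : v ∈ 𝒜 e) (hw : ∀ i, w i ∈ 𝒜 (d i)) (τ : Equiv.Perm (Fin c)) :
    insertLeft R y c (w ∘ τ) v = koszulSign τ d • insertLeft R y c w v := by
  rw [insertLeft_apply, mon₂_prepend_comp_left hv hw, map_sign_smul, insertLeft_apply]

/-- The left hand side of the defining identity of post-Lie`_∞` algebras, with the sums over
shuffles replaced by normalized sums over all permutations. -/
def mcSum (R : ∀ p q : ℕ, GSym 𝒜 p ⊗[k] GSym 𝒜 q →ₗ[k] V) {n m : ℕ} (d : Fin n → ℤ)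
    (d' : Fin m → ℤ) (x : Fin n → V) (y : Fin m → V) : V :=
  (∑ p ∈ antidiagonal n, ∑ q ∈ antidiagonal p.1,
    (invFact k q.1 * invFact k q.2 * invFact k p.2) •
      leftNestSum R (insertLeft R y) d x q.1 q.2 p.2)
  + ∑ p ∈ antidiagonal n, ∑ q ∈ antidiagonal m,
    (invFact k p.1 * invFact k p.2 * invFact k q.1 * invFact k q.2) •
      rightNestSum R d d' x y p.1 p.2 q.1 q.2

/-- For `m = 0` the outer operation in the first sum and the inner one in the second sum take no
argument from the second factor. -/
theorem mcSum_zero (hR : ∀ p, R p 0 = 0) {n : ℕ} (d : Fin n → ℤ) (e : Fin 0 → ℤ)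
    (x : Fin n → V) (y : Fin 0 → V) : mcSum R d e x y = 0 := by
  have h1 : ∀ c (w : Fin c → V) (v : V), insertLeft R y c w v = 0 := by
    intro c w v
    rw [insertLeft_apply, hR, LinearMap.zero_apply]
  simp [mcSum, leftNestSum, rightNestSum, h1, rightNest_zero hR]

variable [CharZero k]

theorem sum_shuffles₂_eq_rightNestSum (hdeg : ∀ p q, IsDegreeOne 𝒜 𝒜 (R p q)) {n m : ℕ}
    {d : Fin n → ℤ} {d' : Fin m → ℤ} {x : Fin n → V} {y : Fin m → V} (hx : ∀ i, x i ∈ 𝒜 (d i))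
    (hy : ∀ i, y i ∈ 𝒜 (d' i)) {c a b e : ℕ} (hca : c + a = n) (hbe : b + e = m) :
    ∑ σ ∈ shuffles₂ n c, ∑ τ ∈ shuffles₂ m b,
        (koszulSign σ d * koszulSign τ d' * headSign (d ∘ σ) c) •
          rightNest R c a b e (x ∘ σ) (y ∘ τ) =
      (invFact k c * invFact k a * invFact k b * invFact k e) •
        rightNestSum R d d' x y c a b e := by
  have ha : a = n - c := by omega
  have he : e = m - b := by omega
  have h1 : ∀ σ : Equiv.Perm (Fin n), ∑ τ ∈ shuffles₂ m b,
        (koszulSign σ d * koszulSign τ d' * headSign (d ∘ σ) c) •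
          rightNest R c a b e (x ∘ σ) (y ∘ τ) =
      (invFact k b * invFact k e) • koszulSign σ d • headSign (d ∘ σ) c •
        ∑ τ : Equiv.Perm (Fin m), koszulSign τ d' • rightNest R c a b e (x ∘ σ) (y ∘ τ) := by
    intro σ
    have h2 : ∀ τ : Equiv.Perm (Fin m), (koszulSign σ d * koszulSign τ d' * headSign (d ∘ σ) c) •
          rightNest R c a b e (x ∘ σ) (y ∘ τ) = koszulSign σ d • headSign (d ∘ σ) c •
          koszulSign τ d' • rightNest R c a b e (x ∘ σ) (y ∘ τ) := by
      intro τ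
      rw [smul_smul, smul_smul, mul_right_comm, mul_assoc]
    simp only [h2]
    rw [← smul_sum, ← smul_sum, ← sign_smul_comm, ← sign_smul_comm, he,
      ← sum_shuffles₂_eq (k := k) (by omega), ← he]
    · intro τ ρ
      exact koszulSign_smul_invariant d' _ (fun τ => rightNest R c a b (m - b) (x ∘ σ) (y ∘ τ)) τ ρ
        (rightNest_comp_right_fst _ (comp_mem hy τ) _ _ _ _ ρ)
    · intro τ ρ
      exact koszulSign_smul_invariant d' _ (fun τ => rightNest R c a b (m - b) (x ∘ σ) (y ∘ τ)) τ ρ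
        (rightNest_comp_right_snd hdeg (comp_mem hx σ) (comp_mem hy τ) _ _ _ ρ)
  simp only [h1]
  rw [← smul_sum, sum_shuffles₂_eq (k := k) (by omega), ← ha, smul_smul, rightNestSum]
  · congr 1
    ring
  all_goals
    intro σ ρ
    refine koszulSign_smul_invariant d _ (fun σ => headSign (d ∘ σ) c •
      ∑ τ : Equiv.Perm (Fin m), koszulSign τ d' • rightNest R c a b e (x ∘ σ) (y ∘ τ)) σ ρ ?_
    simp only [Equiv.Perm.coe_mul, ← Function.comp_assoc, headSign_eq]
  · rw [sum_block_comp, smul_comm]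
    congr 1
    rw [smul_sum]
    refine sum_congr rfl fun τ _ => ?_
    rw [rightNest_comp_left_fst (comp_mem hx σ), smul_comm]
  · subst ha
    rw [block_comp_blockPerm_of_disjoint _ _ _ (by omega), smul_comm]
    congr 1
    rw [smul_sum]
    refine sum_congr rfl fun τ _ => ?_
    rw [rightNest_comp_left_snd (comp_mem hx σ), smul_comm]

/-- The left hand side of the identity for post-Lie`_∞` algebras. -/
theorem maurer_cartan_eq_mcSum (hR : ∀ p, R p 0 = 0) (hdeg : ∀ p q, IsDegreeOne 𝒜 𝒜 (R p q))
    {n m : ℕ} {d : Fin n → ℤ} {e : Fin m → ℤ} {x : Fin n → V} {y : Fin m → V}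
    (hx : ∀ i, x i ∈ 𝒜 (d i)) (hy : ∀ i, y i ∈ 𝒜 (e i)) :
    (∑ j ∈ range n, ∑ i ∈ Icc 1 (n - j), ∑ σ ∈ shuffles₃ n j i,
      koszulSign σ d •
        R (n - j - i + 1) m
          (mon₂ 𝒜 𝒜
            (prepend
              (R j i (mon₂ 𝒜 𝒜 (block (x ∘ σ) 0 j) (block (x ∘ σ) j i)))
              (block (x ∘ σ) (j + i) (n - j - i)))
            y))
    + (∑ j ∈ range (n + 1), ∑ i ∈ Icc 1 m,
        ∑ σ ∈ shuffles₂ n (n - j), ∑ τ ∈ shuffles₂ m i,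
        (koszulSign σ d * koszulSign τ e * headSign (d ∘ σ) (n - j)) •
          R (n - j) (m - i + 1)
            (mon₂ 𝒜 𝒜 (block (x ∘ σ) 0 (n - j))
              (prepend
                (R j i (mon₂ 𝒜 𝒜 (block (x ∘ σ) (n - j) j) (block (y ∘ τ) 0 i)))
                (block (y ∘ τ) i (m - i))))) = mcSum R d e x y := by
  rw [mcSum]
  congr 1
  · rw [← sum_shuffles₃_eq_leftNestSum hR hdeg _ (insertLeft_comp_perm y) hx]
    simp only [opVal, zero_add, insertLeft_apply]
  · rw [← Finset.Nat.sum_antidiagonal_swap,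
      Finset.Nat.sum_antidiagonal_eq_sum_range_succ_mk]
    refine sum_congr rfl fun j hj => ?_
    rw [mem_range] at hj
    rw [← sum_Icc_eq_sum_antidiagonal (fun b e' =>
      (invFact k (j, n - j).swap.1 * invFact k (j, n - j).swap.2 * invFact k b * invFact k e') •
        rightNestSum R d e x y (j, n - j).swap.1 (j, n - j).swap.2 b e')]
    · refine sum_congr rfl fun i hi => ?_
      rw [mem_Icc] at hi
      rw [← sum_shuffles₂_eq_rightNestSum hdeg hx hy (by simp; omega) (by omega)]
      rfl
    · simp only [rightNestSum, rightNest_zero hR, smul_zero, sum_const_zero]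

variable [DirectSum.Decomposition 𝒜]

/-- The left hand side of the compatibility condition of open-closed homotopy Lie algebras, for the
operations `l^C`. -/
theorem compat_eq_mcSum (hR : ∀ p, R p 0 = 0) (hdeg : ∀ p q, IsDegreeOne 𝒜 𝒜 (R p q))
    {n m : ℕ} {d : Fin n → ℤ} {e : Fin m → ℤ} {x : Fin n → V} {u : Fin m → V}
    (hx : ∀ i, x i ∈ 𝒜 (d i)) (hu : ∀ i, u i ∈ 𝒜 (e i)) :
    (∑ i ∈ Icc 1 n, ∑ σ ∈ shuffles₂ n i,
      koszulSign σ d •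
        R (n - i + 1) m
          (mon₂ 𝒜 𝒜 (prepend (subadjacent 𝒜 R i (block (x ∘ σ) 0 i))
            (block (x ∘ σ) i (n - i))) u))
    + (∑ i ∈ range (n + 1), ∑ j ∈ (range (m + 1)).filter (fun j => 1 ≤ n - i + j),
        ∑ σ ∈ shuffles₂ n i, ∑ τ ∈ shuffles₂ m j,
        (koszulSign σ d * koszulSign τ e * headSign (d ∘ σ) i) •
          R i (m - j + 1)
            (mon₂ 𝒜 𝒜 (block (x ∘ σ) 0 i)
              (prepend
                (R (n - i) j (mon₂ 𝒜 𝒜 (block (x ∘ σ) i (n - i)) (block (u ∘ τ) 0 j)))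
                (block (u ∘ τ) j (m - j))))) = mcSum R d e x u := by
  rw [mcSum]
  congr 1
  · rw [← sum_shuffles₂_eq_leftNestSum hR hdeg _ (insertLeft_comp_perm u) hx]
    simp only [insertLeft_apply]
  · rw [Finset.Nat.sum_antidiagonal_eq_sum_range_succ_mk]
    refine sum_congr rfl fun i hi => ?_
    rw [mem_range] at hi
    rw [Finset.Nat.sum_antidiagonal_eq_sum_range_succ (fun b e' =>
      (invFact k i * invFact k (n - i) * invFact k b * invFact k e') •
        rightNestSum R d e x u i (n - i) b e'), sum_filter]
    refine sum_congr rfl fun j hj => ?_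
    rw [mem_range] at hj
    rw [← sum_shuffles₂_eq_rightNestSum hdeg hx hu (by omega) (by omega)]
    split_ifs with h
    · rfl
    · obtain rfl : j = 0 := by omega
      simp only [rightNest_zero hR, smul_zero, sum_const_zero]

end Right

section Jacobi

variable {k V : Type*} [Field k] [AddCommGroup V] [Module k V] {𝒜 : ℤ → Submodule k V}
  {R : ∀ p q : ℕ, GSym 𝒜 p ⊗[k] GSym 𝒜 q →ₗ[k] V}

/-! ### The Jacobi identities from the Maurer–Cartan identities -/

/-- The linear map `v ↦ f (v, w₁, …, w_c)`. -/
def insertFirst {c : ℕ} (f : MultilinearMap k (fun _ : Fin (c + 1) => V) V) (w : Fin c → V) :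
    V →ₗ[k] V where
  toFun v := f (prepend v w)
  map_add' v v' := by simp only [prepend, MultilinearMap.cons_add]
  map_smul' r v := by simp only [prepend, MultilinearMap.cons_smul, RingHom.id_apply]

theorem insertFirst_apply {c : ℕ} (f : MultilinearMap k (fun _ : Fin (c + 1) => V) V)
    (w : Fin c → V) (v : V) : insertFirst f w v = f (prepend v w) := rfl

/-- The term in which the operation on the first two blocks, of sizes `a`, `b`, goes to the first
factor of `Sym ⊗ Sym`, followed by a block of size `c`, and a block of size `e` is the second
factor. -/
def nestLeft (R : ∀ p q : ℕ, GSym 𝒜 p ⊗[k] GSym 𝒜 q →ₗ[k] V) (a b c e : ℕ) {n : ℕ}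
    (x : Fin n → V) : V :=
  insertLeft R (block x (a + b + c) e) c (block x (a + b) c) (opVal R a b 0 x)

/-- The terms of the Jacobi identity in which the inner operation goes to the first factor of
`Sym ⊗ Sym`. -/
def jacobiLeft (R : ∀ p q : ℕ, GSym 𝒜 p ⊗[k] GSym 𝒜 q →ₗ[k] V) (a b c e : ℕ) {n : ℕ}
    (d : Fin n → ℤ) (x : Fin n → V) : V :=
  ∑ σ : Equiv.Perm (Fin n), koszulSign σ d • nestLeft R a b c e (x ∘ σ)

/-- The term in which the operation on the blocks of sizes `a`, `b` goes to the second factor of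
`Sym ⊗ Sym`, preceded by a block of size `c` and followed by one of size `e`. -/
def nestRight (R : ∀ p q : ℕ, GSym 𝒜 p ⊗[k] GSym 𝒜 q →ₗ[k] V) (c a b e : ℕ) {n : ℕ}
    (x : Fin n → V) : V :=
  R c (e + 1) (mon₂ 𝒜 𝒜 (block x 0 c) (prepend (opVal R a b c x) (block x (c + a + b) e)))

/-- The terms of the Jacobi identity in which the inner operation goes to the second factor. -/
def jacobiRight (R : ∀ p q : ℕ, GSym 𝒜 p ⊗[k] GSym 𝒜 q →ₗ[k] V) (c a b e : ℕ) {n : ℕ}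
    (d : Fin n → ℤ) (x : Fin n → V) : V :=
  ∑ σ : Equiv.Perm (Fin n), koszulSign σ d • headSign (d ∘ σ) c • nestRight R c a b e (x ∘ σ)

/-- If both groups of arguments are consecutive blocks of one tuple, the inner operation is applied
to two neighbouring blocks. -/
theorem rightNest_block {n p m c a b e : ℕ} (x : Fin n → V) (hp : c + a = p) (hm : b + e = m) :
    rightNest R c a b e (block x 0 p) (block x p m) = nestRight R c a b e x := by
  subst hp hm
  rw [rightNest, block_block _ (by omega), block_block _ (by omega), block_block _ (by omega),
    block_block _ (by omega), nestRight, opVal]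
  simp only [zero_add, add_zero]

/-- Moving the arguments of the inner operation past `c` elements: the Koszul sign of this move and
the one of moving the result back differ by `(-1)^{d₁ + … + d_c}`, as the operation has degree
one. -/
theorem sum_blockRot_eq_jacobiRight {n a b c e : ℕ} (h : a + b + c ≤ n) (d : Fin n → ℤ)
    (x : Fin n → V) :
    ∑ σ : Equiv.Perm (Fin n), koszulSign σ d •
      Int.negOnePow ((∑ t, block (d ∘ σ) 0 (a + b) t + 1) * ∑ t, block (d ∘ σ) (a + b) c t) •
        R c (e + 1) (mon₂ 𝒜 𝒜 (block (x ∘ σ) (a + b) c)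
          (prepend (opVal R a b 0 (x ∘ σ)) (block (x ∘ σ) (a + b + c) e))) =
      jacobiRight R c a b e d x := by
  rw [jacobiRight, ← Equiv.sum_comp (Equiv.mulRight (blockRot h))
    (fun σ => koszulSign σ d • headSign (d ∘ σ) c • nestRight R c a b e (x ∘ σ))]
  refine sum_congr rfl fun σ _ => ?_
  have h1 : opVal R a b c ((x ∘ σ) ∘ blockRot h) = opVal R a b 0 (x ∘ σ) := by
    rw [opVal, opVal, zero_add, block_comp_blockRot_mid h _ (s := a) (by omega)]
    have := block_comp_blockRot_mid h (x ∘ σ) (s := 0) (a := a) (by omega)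
    rw [add_zero] at this
    rw [this]
  rw [Equiv.coe_mulRight, koszulSign_mul, koszulSign_blockRot, Equiv.Perm.coe_mul,
    ← Function.comp_assoc, ← Function.comp_assoc, headSign_eq, block_comp_blockRot_left, nestRight,
    block_comp_blockRot_left, h1, block_comp_blockRot_right h _ (by omega), mul_smul, smul_smul,
    smul_smul, smul_smul, add_mul, one_mul, Int.negOnePow_add,
    show c + a + b = a + b + c by omega]
  simp only [mul_assoc]

variable [CharZero k]

/-- The permutations of the first `a + b + c` elements are absorbed by the sum over all permutations. -/
theorem sum_leftNestSum_eq_jacobiLeft {n a b c e : ℕ} (h : a + b + c + e = n) (d : Fin n → ℤ)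
    (x : Fin n → V) :
    invFact k (a + b + c) • ∑ σ : Equiv.Perm (Fin n), koszulSign σ d •
      leftNestSum R (insertLeft R (block (x ∘ σ) (a + b + c) e)) (block (d ∘ σ) 0 (a + b + c))
        (block (x ∘ σ) 0 (a + b + c)) a b c = jacobiLeft R a b c e d x := by
  have h0 : 0 + (a + b + c) ≤ n := by omega
  rw [jacobiLeft, ← invFact_smul_sum_blockPerm (k := k) d h0
    (fun σ => nestLeft R a b c e (x ∘ σ))]
  congr 1
  refine sum_congr rfl fun σ _ => ?_
  congr 1
  refine sum_congr rfl fun τ _ => ?_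
  rw [Equiv.Perm.coe_mul, ← Function.comp_assoc, ← block_comp_blockPerm h0, nestLeft,
    block_block _ (by omega), opVal_block _ (by omega),
    block_comp_blockPerm_of_disjoint h0 _ _ (s' := a + b + c) (by omega)]
  simp only [zero_add]

/-- The permutations of the two blocks are absorbed by the sum over all permutations. -/
theorem sum_rightNestSum_eq_jacobiRight {n p m c a b e : ℕ} (hn : p + m = n) (hp : c + a = p)
    (hm : b + e = m) (d : Fin n → ℤ) (x : Fin n → V) :
    (invFact k p * invFact k m) • ∑ σ : Equiv.Perm (Fin n), koszulSign σ d •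
      rightNestSum R (block (d ∘ σ) 0 p) (block (d ∘ σ) p m) (block (x ∘ σ) 0 p)
        (block (x ∘ σ) p m) c a b e = jacobiRight R c a b e d x := by
  have h0 : 0 + p ≤ n := by omega
  have h1 : p + m ≤ n := by omega
  rw [jacobiRight, ← invFact_smul_sum_blockPerm (k := k) d h1
    (fun σ => headSign (d ∘ σ) c • nestRight R c a b e (x ∘ σ)), mul_comm, mul_smul,
    ← invFact_smul_sum_blockPerm (k := k) d h0
      (fun σ => ∑ ρ : Equiv.Perm (Fin m), koszulSign ρ (block (d ∘ σ) p m) •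
        headSign (d ∘ (σ * blockPerm h1 ρ : Equiv.Perm (Fin n))) c •
          nestRight R c a b e (x ∘ (σ * blockPerm h1 ρ : Equiv.Perm (Fin n))))]
  congr 2
  refine sum_congr rfl fun σ _ => ?_
  congr 1
  refine sum_congr rfl fun τ _ => ?_
  congr 1
  rw [smul_sum]
  refine sum_congr rfl fun ρ _ => ?_
  simp only [Equiv.Perm.coe_mul, ← Function.comp_assoc, headSign_eq]
  rw [block_comp_blockPerm_of_disjoint h0 _ _ (s' := p) (by omega),
    block_comp_blockPerm_of_disjoint h1 _ _ (s' := 0) (by omega), smul_comm,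
    ← rightNest_block _ hp hm, block_comp_blockPerm h1,
    block_comp_blockPerm_of_disjoint h1 _ _ (s' := 0) (by omega),
    block_comp_blockPerm_of_disjoint h0 _ _ (s' := p) (by omega), block_comp_blockPerm h0,
    ← block_comp_blockPerm h0 (d ∘ σ), block_block _ (by omega)]

variable [DirectSum.Decomposition 𝒜]

theorem insertFirst_subadjacent_comp_perm (hR : ∀ p, R p 0 = 0) (c : ℕ) (e : ℤ) (d : Fin c → ℤ)
    (v : V) (w : Fin c → V) (hv : v ∈ 𝒜 e) (hw : ∀ i, w i ∈ 𝒜 (d i))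
    (τ : Equiv.Perm (Fin c)) :
    insertFirst (subadjacent 𝒜 R (c + 1)) (w ∘ τ) v =
      koszulSign τ d • insertFirst (subadjacent 𝒜 R (c + 1)) w v := by
  rw [insertFirst_apply, ← prepend_comp_blockPerm v w (by omega) τ,
    subadjacent_comp_perm hR (prepend_mem hv hw), koszulSign_blockPerm_prepend, insertFirst_apply]

/-- In `l^C (v, w)`, with `v` a value of the inner operation, `v` goes to the first or to the second
factor of `Sym ⊗ Sym`. -/
theorem leftNestSum_subadjacent (hR : ∀ p, R p 0 = 0) (hdeg : ∀ p q, IsDegreeOne 𝒜 𝒜 (R p q))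
    {n a b r : ℕ} (h : a + b + r = n) {d : Fin n → ℤ} {x : Fin n → V} (hx : ∀ i, x i ∈ 𝒜 (d i)) :
    invFact k r •
        leftNestSum R (fun c => insertFirst (subadjacent 𝒜 R (c + 1))) d x a b r =
      ∑ s ∈ antidiagonal r, (invFact k s.1 * invFact k s.2) •
        (jacobiLeft R a b s.1 s.2 d x + jacobiRight R s.1 a b s.2 d x) := by
  have h0 : a + b + r ≤ n := h.le
  set G : ℕ → ℕ → Equiv.Perm (Fin n) → V := fun c e σ =>
    nestLeft R a b c e (x ∘ σ) +
    Int.negOnePow ((∑ t, block (d ∘ σ) 0 (a + b) t + 1) * ∑ t, block (d ∘ σ) (a + b) c t) •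
        R c (e + 1) (mon₂ 𝒜 𝒜 (block (x ∘ σ) (a + b) c)
          (prepend (opVal R a b 0 (x ∘ σ)) (block (x ∘ σ) (a + b + c) e))) with hG
  have h1 : ∀ σ : Equiv.Perm (Fin n),
      insertFirst (subadjacent 𝒜 R (r + 1)) (block (x ∘ σ) (a + b) r) (opVal R a b 0 (x ∘ σ)) =
      ∑ s ∈ antidiagonal r, (invFact k s.1 * invFact k s.2) •
        ∑ τ : Equiv.Perm (Fin r), koszulSign τ (block (d ∘ σ) (a + b) r) •
          G s.1 s.2 (σ * blockPerm h0 τ) := by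
    intro σ
    rw [insertFirst_apply, subadjacent_prepend hR (opVal_mem hdeg (comp_mem hx σ) a b 0)
      (block_mem (comp_mem hx σ) _ _)]
    refine sum_congr rfl fun s hs => ?_
    rw [HasAntidiagonal.mem_antidiagonal] at hs
    congr 1
    refine sum_congr rfl fun τ _ => ?_
    congr 1
    simp only [hG, Equiv.Perm.coe_mul, ← Function.comp_assoc, nestLeft, insertLeft_apply]
    rw [← block_comp_blockPerm h0, ← block_comp_blockPerm h0, block_block _ (by omega),
      block_block _ (by omega), block_block _ (by omega), opVal_comp_of_disjoint _ h0 (by omega),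
      block_comp_blockPerm_of_disjoint h0 _ _ (s' := 0) (by omega)]
    rfl
  rw [leftNestSum]
  simp only [h1]
  rw [sum_sign_smul_sum_smul, smul_sum]
  refine sum_congr rfl fun s hs => ?_
  rw [HasAntidiagonal.mem_antidiagonal] at hs
  rw [smul_comm, invFact_smul_sum_blockPerm d h0 (G s.1 s.2)]
  simp only [hG, smul_add, sum_add_distrib]
  rw [sum_blockRot_eq_jacobiRight (by omega), jacobiLeft]

/-- The Jacobi expression of the operations `l^C` is the sum of all Maurer–Cartan expressions
obtained by distributing the arguments to the two factors of `Sym ⊗ Sym`. -/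
theorem jacobi_eq_sum_mcSum (hR : ∀ p, R p 0 = 0) (hdeg : ∀ p q, IsDegreeOne 𝒜 𝒜 (R p q))
    {n : ℕ} {d : Fin n → ℤ} {x : Fin n → V} (hx : ∀ i, x i ∈ 𝒜 (d i)) :
    ∑ i ∈ Icc 1 n, ∑ σ ∈ shuffles₂ n i, koszulSign σ d •
        subadjacent 𝒜 R (n - i + 1) (prepend (subadjacent 𝒜 R i (block (x ∘ σ) 0 i))
          (block (x ∘ σ) i (n - i))) =
      ∑ p ∈ antidiagonal n, (invFact k p.1 * invFact k p.2) •
        ∑ σ : Equiv.Perm (Fin n), koszulSign σ d •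
          mcSum R (block (d ∘ σ) 0 p.1) (block (d ∘ σ) p.1 p.2) (block (x ∘ σ) 0 p.1)
            (block (x ∘ σ) p.1 p.2) := by
  set fL : ℕ → ℕ → ℕ → ℕ → V := fun a b c e =>
    (invFact k a * invFact k b * invFact k c * invFact k e) • jacobiLeft R a b c e d x with hfL
  set fR : ℕ → ℕ → ℕ → ℕ → V := fun c a b e =>
    (invFact k c * invFact k a * invFact k b * invFact k e) • jacobiRight R c a b e d x with hfR
  have hl : ∑ i ∈ Icc 1 n, ∑ σ ∈ shuffles₂ n i, koszulSign σ d •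
        subadjacent 𝒜 R (n - i + 1) (prepend (subadjacent 𝒜 R i (block (x ∘ σ) 0 i))
          (block (x ∘ σ) i (n - i))) =
      ∑ p ∈ antidiagonal n, ∑ q ∈ antidiagonal p.1, ∑ s ∈ antidiagonal p.2,
        (fL q.1 q.2 s.1 s.2 + fR s.1 q.1 q.2 s.2) := by
    have h := sum_shuffles₂_eq_leftNestSum hR hdeg
      (fun c => insertFirst (subadjacent 𝒜 R (c + 1))) (insertFirst_subadjacent_comp_perm hR) hx
    simp only [insertFirst_apply] at h
    rw [h]
    refine sum_congr rfl fun p hp => sum_congr rfl fun q hq => ?_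
    rw [HasAntidiagonal.mem_antidiagonal] at hp hq
    rw [mul_smul, leftNestSum_subadjacent hR hdeg (by omega) hx, smul_sum]
    refine sum_congr rfl fun s _ => ?_
    rw [smul_smul, smul_add, hfL, hfR]
    dsimp only
    congr 2 <;> ring
  have hr : ∀ p ∈ antidiagonal n, (invFact k p.1 * invFact k p.2) •
        ∑ σ : Equiv.Perm (Fin n), koszulSign σ d •
          mcSum R (block (d ∘ σ) 0 p.1) (block (d ∘ σ) p.1 p.2) (block (x ∘ σ) 0 p.1)
            (block (x ∘ σ) p.1 p.2) =
      (∑ r ∈ antidiagonal p.1, ∑ q ∈ antidiagonal r.1, fL q.1 q.2 r.2 p.2) +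
        ∑ q ∈ antidiagonal p.1, ∑ s ∈ antidiagonal p.2, fR q.1 q.2 s.1 s.2 := by
    intro p hp
    rw [HasAntidiagonal.mem_antidiagonal] at hp
    simp only [mcSum, smul_add, sum_add_distrib]
    congr 1
    · simp only [sum_sigma']
      rw [sum_sign_smul_sum_smul, smul_sum]
      refine sum_congr rfl ?_
      rintro ⟨r, q⟩ h
      simp only [mem_sigma, HasAntidiagonal.mem_antidiagonal] at h
      obtain ⟨p1, p2⟩ := p
      dsimp only at h hp ⊢
      obtain rfl : p1 = q.1 + q.2 + r.2 := by omega
      rw [hfL]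
      dsimp only
      rw [← sum_leftNestSum_eq_jacobiLeft (by omega), smul_smul, smul_smul]
      congr 1
      ring
    · simp only [sum_sigma']
      rw [sum_sign_smul_sum_smul, smul_sum]
      refine sum_congr rfl ?_
      rintro ⟨q, s⟩ h
      simp only [mem_sigma, HasAntidiagonal.mem_antidiagonal] at h
      rw [smul_comm, sum_rightNestSum_eq_jacobiRight hp h.1 h.2]
  rw [hl, sum_congr rfl hr]
  simp only [sum_add_distrib]
  rw [sum_antidiagonal_left_eq fL, sum_antidiagonal_mid_eq fR]

end Jacobi

section ExtendByZero

variable {k V : Type*} [Field k] [AddCommGroup V] [Module k V] {𝒜 : ℤ → Submodule k V}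
  (M : ∀ p q : ℕ, GSym 𝒜 p ⊗[k] GSym 𝒜 q →ₗ[k] V)

/-! ### The equivalence -/

theorem extendByZero_zero (p : ℕ) : extendByZero 𝒜 M p 0 = 0 := if_pos rfl

theorem extendByZero_of_pos (p : ℕ) {q : ℕ} (hq : 1 ≤ q) : extendByZero 𝒜 M p q = M p q :=
  if_neg (by omega)

theorem isDegreeOne_extendByZero (hM : ∀ p q : ℕ, 1 ≤ q → IsDegreeOne 𝒜 𝒜 (M p q)) (p q : ℕ) :
    IsDegreeOne 𝒜 𝒜 (extendByZero 𝒜 M p q) := by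
  rcases Nat.eq_zero_or_pos q with rfl | hq
  · intro d e x y _ _
    rw [extendByZero_zero, LinearMap.zero_apply]
    exact zero_mem _
  · rw [extendByZero_of_pos M p hq]
    exact hM p q hq

/-- The operations `l^C` involve only `M_{p,q}` with `q ≥ 1`. -/
theorem subadjacent_extendByZero [DirectSum.Decomposition 𝒜] :
    subadjacent 𝒜 (extendByZero 𝒜 M) = subadjacent 𝒜 M := by
  have h : ∀ (n : ℕ) (j : Fin n) (σ : Equiv.Perm (Fin n)),
      subadjacentTerm 𝒜 (extendByZero 𝒜 M) j σ = subadjacentTerm 𝒜 M j σ := by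
    intro n j σ
    rw [subadjacentTerm, extendByZero_of_pos M j (by omega), subadjacentTerm]
  funext n
  simp only [subadjacent, h]

/-- The identity for post-Lie`_∞` algebras involves only operations `M_{p,q}` with `q ≥ 1`. -/
theorem maurer_cartan_extendByZero [CharZero k]
    (hM : ∀ p q : ℕ, 1 ≤ q → IsDegreeOne 𝒜 𝒜 (M p q)) {n m : ℕ} (hm : 1 ≤ m)
    {d : Fin n → ℤ} {e : Fin m → ℤ} {x : Fin n → V} {y : Fin m → V}
    (hx : ∀ i, x i ∈ 𝒜 (d i)) (hy : ∀ i, y i ∈ 𝒜 (e i)) :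
    (∑ j ∈ range n, ∑ i ∈ Icc 1 (n - j), ∑ σ ∈ shuffles₃ n j i,
      koszulSign σ d •
        M (n - j - i + 1) m
          (mon₂ 𝒜 𝒜
            (prepend
              (M j i (mon₂ 𝒜 𝒜 (block (x ∘ σ) 0 j) (block (x ∘ σ) j i)))
              (block (x ∘ σ) (j + i) (n - j - i)))
            y))
    + (∑ j ∈ range (n + 1), ∑ i ∈ Icc 1 m,
        ∑ σ ∈ shuffles₂ n (n - j), ∑ τ ∈ shuffles₂ m i,
        (koszulSign σ d * koszulSign τ e * headSign (d ∘ σ) (n - j)) •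
          M (n - j) (m - i + 1)
            (mon₂ 𝒜 𝒜 (block (x ∘ σ) 0 (n - j))
              (prepend
                (M j i (mon₂ 𝒜 𝒜 (block (x ∘ σ) (n - j) j) (block (y ∘ τ) 0 i)))
                (block (y ∘ τ) i (m - i))))) = mcSum (extendByZero 𝒜 M) d e x y := by
  rw [← maurer_cartan_eq_mcSum (extendByZero_zero M) (isDegreeOne_extendByZero M hM) hx hy]
  congr 1
  · refine sum_congr rfl fun j _ => sum_congr rfl fun i hi => ?_
    rw [mem_Icc] at hi
    rw [extendByZero_of_pos M _ hm, extendByZero_of_pos M _ hi.1]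
  · refine sum_congr rfl fun j _ => sum_congr rfl fun i hi => ?_
    rw [mem_Icc] at hi
    rw [extendByZero_of_pos M _ (Nat.le_add_left 1 _), extendByZero_of_pos M _ hi.1]

end ExtendByZero

end PostLieInfty

end

theorem mainTheorem4 {k : Type*} [Field k] [CharZero k] {V : Type*} [AddCommGroup V] [Module k V]
    (𝒜 : ℤ → Submodule k V) [DirectSum.Decomposition 𝒜]
    (M : ∀ p q : ℕ, PostLieInfty.GSym 𝒜 p ⊗[k] PostLieInfty.GSym 𝒜 q →ₗ[k] V)
    (hM : ∀ p q : ℕ, 1 ≤ q → PostLieInfty.IsDegreeOne 𝒜 𝒜 (M p q)) :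
    PostLieInfty.IsPostLieInfty 𝒜 M ↔
      PostLieInfty.IsOpenClosed 𝒜 𝒜 (PostLieInfty.subadjacent 𝒜 M)
        (PostLieInfty.extendByZero 𝒜 M) := by
  have hR := PostLieInfty.extendByZero_zero M
  have hdeg := PostLieInfty.isDegreeOne_extendByZero M hM
  rw [← PostLieInfty.subadjacent_extendByZero M]
  constructor
  · intro h
    -- for `m = 0` this holds because of `M_{p,0} = 0`
    have hmc : ∀ (n m : ℕ) (d : Fin n → ℤ) (e : Fin m → ℤ) (x : Fin n → V) (y : Fin m → V),
        (∀ i, x i ∈ 𝒜 (d i)) → (∀ i, y i ∈ 𝒜 (e i)) →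
        PostLieInfty.mcSum (PostLieInfty.extendByZero 𝒜 M) d e x y = 0 := by
      intro n m d e x y hx hy
      rcases Nat.eq_zero_or_pos m with rfl | hm
      · exact PostLieInfty.mcSum_zero hR d e x y
      · rw [← PostLieInfty.maurer_cartan_extendByZero M hM hm hx hy]
        exact h.maurer_cartan n m hm d e x y hx hy
    refine ⟨⟨?_, ?_, ?_⟩, ?_, ?_⟩
    · intro n _ d x hx
      exact PostLieInfty.subadjacent_mem hR hdeg hx
    · intro n _ d x hx σ
      exact PostLieInfty.subadjacent_comp_perm hR hx σ
    · intro n d x hx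
      rw [PostLieInfty.jacobi_eq_sum_mcSum hR hdeg hx]
      refine sum_eq_zero fun p _ => ?_
      rw [sum_eq_zero fun σ _ => ?_, smul_zero]
      rw [hmc _ _ _ _ _ _ (PostLieInfty.block_mem (PostLieInfty.comp_mem hx σ) _ _)
        (PostLieInfty.block_mem (PostLieInfty.comp_mem hx σ) _ _), smul_zero]
    · intro p q _
      exact hdeg p q
    · intro n m _ d e x u hx hu
      rw [PostLieInfty.compat_eq_mcSum hR hdeg hx hu]
      exact hmc n m d e x u hx hu
  · intro h
    refine ⟨hM, ?_⟩
    intro n m hm d e x y hx hy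
    rw [PostLieInfty.maurer_cartan_extendByZero M hM hm hx hy,
      ← PostLieInfty.compat_eq_mcSum hR hdeg hx hy]
    exact h.compat n m (by omega) d e x y hx hy
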